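/- For finite-dimensional complex vector spaces $A,B,C$ and $T\in A\otimes B\otimes C$, let the rank $\mathrm R(T)$ be the least $r$ such that $T$ is a sum of $r$ simple tensors $x\otimes y\otimes z$, and let the border rank $\underline{\mathrm R}(T)$ be the least $r$ such that $T$ is a limit (in the Euclidean topology) of a sequence of tensors of rank at most $r$. The Kronecker product of $T\in A\otimes B\otimes C$ and $S\in A'\otimes B'\otimes C'$ is the tensor $T\boxtimes S\in (A\otimes A')\otimes(B\otimes B')\otimes(C\otimes C')$, bilinear in $(T,S)$, with $(a\otimes b\otimes c)\boxtimes(a'\otimes b'\otimes c')=(a\otimes a')\otimes(b\otimes b')\otimes(c\otimes c')$; put $T^{\boxtimes 3}=(T\boxtimes T)\boxtimes T$. For $q\ge 1$ the little Coppersmith–Winograd tensor is \[ T_{cw,q}=\sum_{j=1}^{q}\bigl(a_0\otimes b_j\otimes c_j+a_j\otimes b_0\otimes c_j+a_j\otimes b_j\otimes c_0\bigr)\in(\mathbb C^{q+1})^{\otimes 3}, \] where $(a_i)_{i=0}^q$, $(b_i)_{i=0}^q$, $(c_i)_{i=0}^q$ each denote the standard basis of $\mathbb C^{q+1}$. **Theorem.**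 For every integer $q\ge 5$, \[ \underline{\mathrm R}\bigl(T_{cw,q}^{\boxtimes 3}\bigr)=(q+2)^3 . \] -/

import Mathlib

open scoped TensorProduct

noncomputable section

section TensorRank

variable {A B C A' B' C' : Type*}
  [AddCommGroup A] [Module ℂ A] [AddCommGroup B] [Module ℂ B] [AddCommGroup C] [Module ℂ C]
  [AddCommGroup A'] [Module ℂ A'] [AddCommGroup B'] [Module ℂ B'] [AddCommGroup C'] [Module ℂ C']

/-- `T` is a sum of `r` simple tensors `x ⊗ y ⊗ z`. -/
def IsSumOfSimple (T : A ⊗[ℂ] (B ⊗[ℂ] C)) (r : ℕ) : Prop :=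
  ∃ (x : Fin r → A) (y : Fin r → B) (z : Fin r → C), T = ∑ l, x l ⊗ₜ[ℂ] (y l ⊗ₜ[ℂ] z l)

/-- The tensor rank `R(T)`: the least `r` such that `T` is a sum of `r` simple tensors. -/
def tensorRank (T : A ⊗[ℂ] (B ⊗[ℂ] C)) : ℕ :=
  sInf {r | IsSumOfSimple T r}

/-- `T` is the limit of a sequence of tensors of rank at most `r`. The limit is taken in the
module topology, which on a finite-dimensional complex vector space is the Euclidean topology. -/
def IsLimitOfRankLE (T : A ⊗[ℂ] (B ⊗[ℂ] C)) (r : ℕ) : Prop :=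
  ∃ u : ℕ → A ⊗[ℂ] (B ⊗[ℂ] C), (∀ n, tensorRank (u n) ≤ r) ∧
    Filter.Tendsto u Filter.atTop (@nhds _ (moduleTopology ℂ (A ⊗[ℂ] (B ⊗[ℂ] C))) T)

/-- The border rank: the least `r` such that `T` is a limit of tensors of rank at most `r`. -/
def borderRank (T : A ⊗[ℂ] (B ⊗[ℂ] C)) : ℕ :=
  sInf {r | IsLimitOfRankLE T r}

/-- Every tensor is a finite sum of simple tensors, so the minimum in `tensorRank` exists. -/
theorem exists_isSumOfSimple (T : A ⊗[ℂ] (B ⊗[ℂ] C)) : ∃ r, IsSumOfSimple T r := by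
  have hadd : ∀ S T : A ⊗[ℂ] (B ⊗[ℂ] C), (∃ r, IsSumOfSimple S r) → (∃ r, IsSumOfSimple T r) →
      ∃ r, IsSumOfSimple (S + T) r := by
    rintro S T ⟨r, x, y, z, rfl⟩ ⟨s, x', y', z', rfl⟩
    refine ⟨r + s, Fin.append x x', Fin.append y y', Fin.append z z', ?_⟩
    simp [Fin.sum_univ_add]
  have hzero : ∃ r, IsSumOfSimple (0 : A ⊗[ℂ] (B ⊗[ℂ] C)) r :=
    ⟨0, Fin.elim0, Fin.elim0, Fin.elim0, by simp⟩
  induction T using TensorProduct.induction_on with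
  | zero => exact hzero
  | add S T hS hT => exact hadd S T hS hT
  | tmul a w =>
    induction w using TensorProduct.induction_on with
    | zero => simpa using hzero
    | add v w hv hw => simpa [TensorProduct.tmul_add] using hadd _ _ hv hw
    | tmul b c => exact ⟨1, fun _ => a, fun _ => b, fun _ => c, by simp⟩

/-- The minimum in `borderRank` exists. -/
theorem exists_isLimitOfRankLE (T : A ⊗[ℂ] (B ⊗[ℂ] C)) : ∃ r, IsLimitOfRankLE T r :=
  ⟨tensorRank T, fun _ => T, fun _ => le_rfl,
    letI := moduleTopology ℂ (A ⊗[ℂ] (B ⊗[ℂ] C)); tendsto_const_nhds⟩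

/-- The Kronecker product `T ⊠ S` of two tensors of order three; it is bilinear and sends
`(a ⊗ b ⊗ c, a' ⊗ b' ⊗ c')` to `(a ⊗ a') ⊗ (b ⊗ b') ⊗ (c ⊗ c')`. -/
def kronecker (T : A ⊗[ℂ] (B ⊗[ℂ] C)) (S : A' ⊗[ℂ] (B' ⊗[ℂ] C')) :
    (A ⊗[ℂ] A') ⊗[ℂ] ((B ⊗[ℂ] B') ⊗[ℂ] (C ⊗[ℂ] C')) :=
  (TensorProduct.tensorTensorTensorComm ℂ B C B' C').toLinearMap.lTensor (A ⊗[ℂ] A')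
    (TensorProduct.tensorTensorTensorComm ℂ A (B ⊗[ℂ] C) A' (B' ⊗[ℂ] C') (T ⊗ₜ[ℂ] S))

theorem kronecker_tmul (a : A) (b : B) (c : C) (a' : A') (b' : B') (c' : C') :
    kronecker (a ⊗ₜ[ℂ] (b ⊗ₜ[ℂ] c)) (a' ⊗ₜ[ℂ] (b' ⊗ₜ[ℂ] c')) =
      (a ⊗ₜ[ℂ] a') ⊗ₜ[ℂ] ((b ⊗ₜ[ℂ] b') ⊗ₜ[ℂ] (c ⊗ₜ[ℂ] c')) := by
  simp [kronecker]

/-- The Kronecker cube `T^{⊠3} = (T ⊠ T) ⊠ T`. -/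
def kroneckerCube (T : A ⊗[ℂ] (B ⊗[ℂ] C)) :
    ((A ⊗[ℂ] A) ⊗[ℂ] A) ⊗[ℂ] (((B ⊗[ℂ] B) ⊗[ℂ] B) ⊗[ℂ] ((C ⊗[ℂ] C) ⊗[ℂ] C)) :=
  kronecker (kronecker T T) T

end TensorRank

/-- The standard basis vector `e_i` of `ℂ^{q+1}`, `0 ≤ i ≤ q`. -/
def stdVec (q : ℕ) (i : Fin (q + 1)) : Fin (q + 1) → ℂ := Pi.single i 1

/-- The little Coppersmith–Winograd tensor
`∑_{j=1}^q (a_0 ⊗ b_j ⊗ c_j + a_j ⊗ b_0 ⊗ c_j + a_j ⊗ b_j ⊗ c_0)` in `(ℂ^{q+1})^{⊗3}`. -/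
def littleCW (q : ℕ) :
    (Fin (q + 1) → ℂ) ⊗[ℂ] ((Fin (q + 1) → ℂ) ⊗[ℂ] (Fin (q + 1) → ℂ)) :=
  ∑ j : Fin q,
    (stdVec q 0 ⊗ₜ[ℂ] (stdVec q j.succ ⊗ₜ[ℂ] stdVec q j.succ)
      + stdVec q j.succ ⊗ₜ[ℂ] (stdVec q 0 ⊗ₜ[ℂ] stdVec q j.succ)
      + stdVec q j.succ ⊗ₜ[ℂ] (stdVec q j.succ ⊗ₜ[ℂ] stdVec q 0))

end

/-! The upper bound comes from a curve of tensors of rank at most `q + 2` tending to `littleCW q`;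
the Kronecker cube of this curve has rank at most `(q + 2) ^ 3` and tends to the cube.

The lower bound is a Koszul flattening. Five functionals on the first factor turn a tensor into a
map built on `Λ² ℂ⁵ → Λ³ ℂ⁵`. A simple tensor yields rank at most 6 (`rank_koszul_le`), and a
nonzero minor stays nonzero near the limit (`card_le_of_isLimitOfRankLE`), so a flattening of rank
`6 (q + 2) ^ 3` suffices.

The slices of the little Coppersmith–Winograd tensor are compressions of multiplication operators of
a commutative Frobenius algebra of dimension `q + 2`: the coordinate of `1` is forgotten on both
sides. The five functionals belong to `1, f₁, …, f₄` in the threefold tensor power of this algebra.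
Because `1` is among them, the flattening has an invertible corner before compression, and the Schur
complement vanishes: `eᵢ ∧ eⱼ` is antisymmetric while `fᵢ fⱼ` is symmetric. Hence the compressed
flattening is `L H Lᵀ` with `H` invertible of size `6 (q + 2) ^ 3` (`leftFactor_mul`), and
everything rests on the injectivity of `L` (`eq_zero_of_leftFactor_mulVec`).

In `L v = 0` the upper rows kill the coordinates of `v` at monomials without digit `0`; the lower
rows are sparse relations for the others. The `fᵢ` are such that these can be solved one unknown at
a time. Their monomials only have digits up to 6, so larger digits are inert and a single finite
check, with 7 standing for every larger digit, settles all `q`. The assumption `5 ≤ q` makes the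
digits up to 6 available; it is also what the size constraint `6 (q + 2) ^ 3 ≤ 10 (q + 1) ^ 3`
demands. -/

/-! ### A triangular system of linear relations

Fix the algebra with basis `1, s, x₂, x₃, …` (indexed by `0, 1, 2, 3, …`) and products
`xₐ xₐ = s`, all other products of basis vectors different from `1` being zero. Monomials in three
copies of it are triples of natural numbers. -/

/-- The monomials of the four elements `f₁, f₂, f₃, f₄` of the threefold tensor power. -/
def monomialsOf : ℕ → List (ℕ × ℕ × ℕ)
  | 0 => [(0, 0, 2), (0, 2, 5), (0, 3, 3), (0, 4, 5), (0, 5, 0), (2, 0, 6), (3, 0, 0), (5, 0, 2),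
      (5, 5, 0), (6, 3, 3)]
  | 1 => [(0, 0, 4), (0, 2, 0), (0, 6, 3), (2, 0, 0), (3, 6, 0), (5, 4, 3), (6, 4, 0)]
  | 2 => [(0, 3, 0), (0, 5, 5), (0, 6, 4), (3, 2, 0), (4, 4, 0), (5, 0, 0), (6, 0, 2), (6, 4, 4)]
  | _ => [(0, 0, 5), (0, 4, 0), (0, 6, 6), (4, 0, 0), (5, 0, 3)]

/-- The index `w` with `xₐ x_w = x_u`, if there is one (for `a ≠ 1`). -/
def digitDiv (u a : ℕ) : Option ℕ :=
  if a = 0 then some u else if u = 1 then some a else if u = a then some 0 else none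

/-- The monomial whose product with `m` is `u`, if there is one. -/
def monomialDiv (u m : ℕ × ℕ × ℕ) : Option (ℕ × ℕ × ℕ) :=
  (digitDiv u.1 m.1).bind fun a => (digitDiv u.2.1 m.2.1).bind fun b =>
    (digitDiv u.2.2 m.2.2).map fun c => (a, b, c)

/-- The triples `(i, l, ε)` with `eᵢ ∧ eₜ = ε e_l`, where `e_l` is the `l`-th vector of the
lexicographic basis of `Λ² ℂ⁴`. -/
def incidence : ℕ → List (ℕ × ℕ × ℤ)
  | 0 => [(1, 0, -1), (2, 1, -1), (3, 2, -1)]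
  | 1 => [(0, 0, 1), (2, 3, -1), (3, 4, -1)]
  | 2 => [(0, 1, 1), (1, 3, 1), (3, 5, -1)]
  | _ => [(0, 2, 1), (1, 4, 1), (2, 5, 1)]

/-- The terms of the relation with index `(t, u)`. -/
def relationTerms (t : ℕ) (u : ℕ × ℕ × ℕ) : List (ℤ × ℕ × ℕ × ℕ × ℕ) :=
  (incidence t).flatMap fun p =>
    (monomialsOf p.1).filterMap fun m => (monomialDiv u m).map fun w => (p.2.2, p.2.1, w)

/-! ### Elimination on bit masks. -/

/-- The code of an unknown whose monomial has digits below `8`. -/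
def unknownCode (l : ℕ) (w : ℕ × ℕ × ℕ) : ℕ := 512 * l + 64 * w.1 + 8 * w.2.1 + w.2.2

/-- The monomials with all digits between `1` and `7`. -/
def fullMonomials : List (ℕ × ℕ × ℕ) :=
  [7, 6, 5, 4, 3, 2, 1].flatMap fun a => [7, 6, 5, 4, 3, 2, 1].flatMap fun b =>
    [7, 6, 5, 4, 3, 2, 1].map fun c => (a, b, c)

/-- The relations between the unknowns with digits below `8`, as lists of codes. -/
def codedRelations : List (List ℕ) :=
  [0, 1, 2, 3].flatMap fun t => fullMonomials.map fun u =>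
    (relationTerms t u).map fun p => unknownCode p.2.1 p.2.2

/-- The set, as a bit mask, of the unknowns whose monomial has no digit `0`. -/
def initialMask : ℕ :=
  ([0, 1, 2, 3, 4, 5].flatMap fun l => fullMonomials.map (unknownCode l)).foldl
    (fun m x => m ||| 1 <<< x) 0

/-- Run once through a list of relations; whenever all unknowns of a relation but one lie in the
set `m`, add the remaining one. -/
def eliminate : List (List ℕ) → ℕ → ℕ
  | [], m => m
  | e :: es, m => match e.filter (fun x => !m.testBit x) with
    -- Both branches pass on the same mask; the case split only forces the mask to be evaluated to a
    -- numeral before the recursion continues.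
    | [x] => match m ||| 1 <<< x with
      | 0 => eliminate es 0
      | k + 1 => eliminate es (k + 1)
    | _ => eliminate es m

/-- Nine passes reach every unknown: the codes are the numbers below `6 * 512 = 3072`, so the final
mask has all its bits set. -/
theorem eliminate_initialMask :
    (List.range 9).foldl (fun m _ => eliminate codedRelations m) initialMask = 2 ^ 3072 - 1 := by
  decide +kernel

/-! ### Soundness of the elimination. -/

/-- The function `W` vanishes on the set with bit mask `m`. -/
def VanishesOn (W : ℕ → ℂ) (m : ℕ) : Prop := ∀ x, m.testBit x = true → W x = 0

/-- Some linear combination of the `W x`, `x ∈ e`, with nonzero coefficients is zero. -/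
def HasRelation (W : ℕ → ℂ) (e : List ℕ) : Prop :=
  ∃ s : List (ℂ × ℕ), s.map Prod.snd = e ∧ (∀ p ∈ s, p.1 ≠ 0) ∧
    (s.map fun p => p.1 * W p.2).sum = 0

theorem VanishesOn.lor {W : ℕ → ℂ} {m x : ℕ} (hm : VanishesOn W m) (hx : W x = 0) :
    VanishesOn W (m ||| 1 <<< x) := by
  intro y hy
  rw [Nat.testBit_or, Bool.or_eq_true] at hy
  rcases hy with hy | hy
  · exact hm y hy
  · rw [Nat.one_shiftLeft, Nat.testBit_two_pow] at hy
    simp only [decide_eq_true_eq] at hy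
    exact hy ▸ hx

/-- Only one term of the relation survives, and its coefficient is nonzero. Filtering a list keeps
multiplicities, so a repeated unknown, whose coefficients might cancel, is never taken for a single
one. -/
theorem HasRelation.eq_zero {W : ℕ → ℂ} {e : List ℕ} {m x : ℕ} (he : HasRelation W e)
    (hm : VanishesOn W m) (hx : e.filter (fun y => !m.testBit y) = [x]) : W x = 0 := by
  obtain ⟨s, rfl, hs, hsum⟩ := he
  have key : ∀ s : List (ℂ × ℕ), (s.map fun p => p.1 * W p.2).sum =
      ((s.filter fun p => !m.testBit p.2).map fun p => p.1 * W p.2).sum := by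
    intro s
    induction s with
    | nil => rfl
    | cons p s ih =>
      by_cases hp : m.testBit p.2 = true
      · simp [hp, hm _ hp, ih]
      · simp [hp, ih]
  rw [key] at hsum
  rw [List.filter_map, List.map_eq_singleton_iff] at hx
  obtain ⟨p, hp, rfl⟩ := hx
  have hmem : p ∈ s.filter ((fun y => !m.testBit y) ∘ Prod.snd) := by rw [hp]; simp
  have hfil : s.filter (fun p => !m.testBit p.2) = [p] := hp
  rw [hfil] at hsum
  simp only [List.map_cons, List.map_nil, List.sum_cons, List.sum_nil, add_zero] at hsum
  exact (mul_eq_zero.1 hsum).resolve_left (hs p (List.mem_of_mem_filter hmem))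

theorem VanishesOn.eliminate {W : ℕ → ℂ} : ∀ (es : List (List ℕ)) (m : ℕ),
    (∀ e ∈ es, HasRelation W e) → VanishesOn W m → VanishesOn W (eliminate es m)
  | [], _, _, hm => hm
  | e :: es, m, hes, hm => by
    have hes' : ∀ e ∈ es, HasRelation W e := fun e h => hes e (List.mem_cons_of_mem _ h)
    rw [_root_.eliminate]
    split
    · next x hx =>
      have h := hm.lor ((hes e List.mem_cons_self).eq_zero hm hx)
      split
      · next h0 => rw [h0] at h; exact VanishesOn.eliminate es 0 hes' h
      · next k hk => rw [hk] at h; exact VanishesOn.eliminate es _ hes' h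
    · exact VanishesOn.eliminate es m hes' hm

theorem vanishesOn_foldl_lor {W : ℕ → ℂ} : ∀ (xs : List ℕ) (m : ℕ), (∀ x ∈ xs, W x = 0) →
    VanishesOn W m → VanishesOn W (xs.foldl (fun m x => m ||| 1 <<< x) m)
  | [], _, _, hm => hm
  | x :: xs, _, hxs, hm =>
    vanishesOn_foldl_lor xs _ (fun y hy => hxs y (List.mem_cons_of_mem _ hy))
      (hm.lor (hxs x List.mem_cons_self))

/-- A function on codes that satisfies all relations and vanishes on full monomials is zero. -/
theorem eq_zero_of_codedRelations {W : ℕ → ℂ} (hes : ∀ e ∈ codedRelations, HasRelation W e)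
    (h0 : ∀ l < 6, ∀ u ∈ fullMonomials, W (unknownCode l u) = 0) {x : ℕ} (hx : x < 3072) :
    W x = 0 := by
  have h1 : VanishesOn W initialMask := by
    refine vanishesOn_foldl_lor _ _ ?_ (fun x hx => by simp at hx)
    intro x hx
    rw [List.mem_flatMap] at hx
    obtain ⟨l, hl, hx⟩ := hx
    rw [List.mem_map] at hx
    obtain ⟨u, hu, rfl⟩ := hx
    exact h0 l (by simp at hl; omega) u hu
  have h2 : ∀ (xs : List ℕ) (m : ℕ), VanishesOn W m →
      VanishesOn W (xs.foldl (fun m _ => eliminate codedRelations m) m) := by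
    intro xs
    induction xs with
    | nil => exact fun m hm => hm
    | cons x xs ih => exact fun m hm => ih _ (hm.eliminate _ _ hes)
  have h3 := h2 (List.range 9) _ h1
  rw [eliminate_initialMask] at h3
  exact h3 x (by rw [Nat.testBit_two_pow_sub_one]; simpa using hx)

/-! ### Reduction of arbitrary digits to digits below 8. -/

/-- Replace the digit `7` by `ρ`. -/
def liftDigit (ρ d : ℕ) : ℕ := if d = 7 then ρ else d

/-- Replace the digits `7` of a monomial by the digits of `ρ`. -/
def liftMonomial (ρ w : ℕ × ℕ × ℕ) : ℕ × ℕ × ℕ :=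
  (liftDigit ρ.1 w.1, liftDigit ρ.2.1 w.2.1, liftDigit ρ.2.2 w.2.2)

/-- A digit `ρ ≥ 7` differs from `1` and from `a`, so it can only be divided by the unit, exactly
like the digit 7. -/
theorem digitDiv_liftDigit {ρ a : ℕ} (hρ : 7 ≤ ρ) (ha : a ≤ 6) (u : ℕ) :
    digitDiv (liftDigit ρ u) a = (digitDiv u a).map (liftDigit ρ) := by
  unfold digitDiv liftDigit
  by_cases h7 : u = 7
  · subst h7
    by_cases h0 : a = 0
    · simp [h0]
    · have h1 : ρ ≠ 1 := by omega
      have h2 : ρ ≠ a := by omega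
      have h3 : 7 ≠ a := by omega
      simp [h0, h1, h2, h3]
  · have h3 : a ≠ 7 := by omega
    rw [if_neg h7]
    split_ifs <;> simp [*]

theorem monomialsOf_le_six (i : ℕ) : ∀ m ∈ monomialsOf i, m.1 ≤ 6 ∧ m.2.1 ≤ 6 ∧ m.2.2 ≤ 6 := by
  match i with
  | 0 => decide
  | 1 => decide
  | 2 => decide
  | _ + 3 => exact (by decide : ∀ m ∈ monomialsOf 3, m.1 ≤ 6 ∧ m.2.1 ≤ 6 ∧ m.2.2 ≤ 6)

theorem monomialsOf_ne_one (i : ℕ) : ∀ m ∈ monomialsOf i, m.1 ≠ 1 ∧ m.2.1 ≠ 1 ∧ m.2.2 ≠ 1 := by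
  match i with
  | 0 => decide
  | 1 => decide
  | 2 => decide
  | _ + 3 => exact (by decide : ∀ m ∈ monomialsOf 3, m.1 ≠ 1 ∧ m.2.1 ≠ 1 ∧ m.2.2 ≠ 1)

theorem monomialDiv_liftMonomial {ρ m : ℕ × ℕ × ℕ} (hρ : 7 ≤ ρ.1 ∧ 7 ≤ ρ.2.1 ∧ 7 ≤ ρ.2.2)
    (hm : m.1 ≤ 6 ∧ m.2.1 ≤ 6 ∧ m.2.2 ≤ 6) (u : ℕ × ℕ × ℕ) :
    monomialDiv (liftMonomial ρ u) m = (monomialDiv u m).map (liftMonomial ρ) := by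
  simp only [monomialDiv, liftMonomial, digitDiv_liftDigit hρ.1 hm.1,
    digitDiv_liftDigit hρ.2.1 hm.2.1, digitDiv_liftDigit hρ.2.2 hm.2.2]
  cases digitDiv u.1 m.1 <;> cases digitDiv u.2.1 m.2.1 <;> cases digitDiv u.2.2 m.2.2 <;> rfl

theorem relationTerms_liftMonomial {ρ : ℕ × ℕ × ℕ} (hρ : 7 ≤ ρ.1 ∧ 7 ≤ ρ.2.1 ∧ 7 ≤ ρ.2.2)
    (t : ℕ) (u : ℕ × ℕ × ℕ) : relationTerms t (liftMonomial ρ u) =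
      (relationTerms t u).map fun p => (p.1, p.2.1, liftMonomial ρ p.2.2) := by
  rw [relationTerms, relationTerms, List.map_flatMap]
  congr 1
  funext p
  rw [List.map_filterMap]
  refine List.filterMap_congr fun m hm => ?_
  rw [monomialDiv_liftMonomial hρ (monomialsOf_le_six _ m hm)]
  cases monomialDiv u m <;> rfl

theorem digitDiv_lt_eight {u a w : ℕ} (hu : u < 8) (ha : a ≤ 6) (h : digitDiv u a = some w) :
    w < 8 := by
  unfold digitDiv at h
  split_ifs at h <;> simp at h <;> omega

theorem relationTerms_lt_eight {t : ℕ} {u : ℕ × ℕ × ℕ} (hu : u.1 < 8 ∧ u.2.1 < 8 ∧ u.2.2 < 8)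
    {p : ℤ × ℕ × ℕ × ℕ × ℕ} (hp : p ∈ relationTerms t u) :
    p.2.2.1 < 8 ∧ p.2.2.2.1 < 8 ∧ p.2.2.2.2 < 8 := by
  rw [relationTerms, List.mem_flatMap] at hp
  obtain ⟨r, -, hp⟩ := hp
  rw [List.mem_filterMap] at hp
  obtain ⟨m, hm, hp⟩ := hp
  have hm := monomialsOf_le_six _ m hm
  simp only [monomialDiv, Option.map_eq_some_iff, Option.bind_eq_some_iff] at hp
  obtain ⟨w, ⟨a, ha, b, hb, c, hc, rfl⟩, rfl⟩ := hp
  exact ⟨digitDiv_lt_eight hu.1 hm.1 ha, digitDiv_lt_eight hu.2.1 hm.2.1 hb,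
    digitDiv_lt_eight hu.2.2 hm.2.2 hc⟩

theorem relationTerms_sign_ne_zero {t : ℕ} {u : ℕ × ℕ × ℕ} {p : ℤ × ℕ × ℕ × ℕ × ℕ}
    (hp : p ∈ relationTerms t u) : p.1 ≠ 0 := by
  have h : ∀ t, ∀ r ∈ incidence t, r.2.2 ≠ 0 := fun t => by
    match t with
    | 0 => decide
    | 1 => decide
    | 2 => decide
    | _ + 3 => exact (by decide : ∀ r ∈ incidence 3, r.2.2 ≠ 0)
  rw [relationTerms, List.mem_flatMap] at hp
  obtain ⟨r, hr, hp⟩ := hp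
  rw [List.mem_filterMap] at hp
  obtain ⟨m, -, hp⟩ := hp
  rw [Option.map_eq_some_iff] at hp
  obtain ⟨w, -, rfl⟩ := hp
  exact h t r hr

theorem mem_fullMonomials {u : ℕ × ℕ × ℕ} (hu : u ∈ fullMonomials) :
    (u.1 ≠ 0 ∧ u.2.1 ≠ 0 ∧ u.2.2 ≠ 0) ∧ u.1 < 8 ∧ u.2.1 < 8 ∧ u.2.2 < 8 := by
  simp only [fullMonomials, List.mem_flatMap, List.mem_map] at hu
  obtain ⟨a, ha, b, hb, c, hc, rfl⟩ := hu
  simp at ha hb hc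
  dsimp
  omega

/-- The relations have no nonzero solution that vanishes at all monomials without a digit `0`. -/
theorem eq_zero_of_relationTerms (V : ℕ → ℕ × ℕ × ℕ → ℂ)
    (h0 : ∀ l < 6, ∀ w : ℕ × ℕ × ℕ, w.1 ≠ 0 → w.2.1 ≠ 0 → w.2.2 ≠ 0 → V l w = 0)
    (hV : ∀ t < 4, ∀ u : ℕ × ℕ × ℕ, u.1 ≠ 0 → u.2.1 ≠ 0 → u.2.2 ≠ 0 →
      ((relationTerms t u).map fun p => (p.1 : ℂ) * V p.2.1 p.2.2).sum = 0)
    {l : ℕ} (hl : l < 6) (w : ℕ × ℕ × ℕ) : V l w = 0 := by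
  -- With this `ρ`, the given `w` is the lift of the monomial with digits `min · 7`, so the finite
  -- system pulled back along the lift contains the unknown at `w`.
  set ρ : ℕ × ℕ × ℕ := (max w.1 7, max w.2.1 7, max w.2.2 7) with hρdef
  have hρ : 7 ≤ ρ.1 ∧ 7 ≤ ρ.2.1 ∧ 7 ≤ ρ.2.2 := by simp [hρdef]
  set W : ℕ → ℂ := fun x => V (x / 512) (liftMonomial ρ (x / 64 % 8, x / 8 % 8, x % 8)) with hW
  have hcode : ∀ (l : ℕ) (w : ℕ × ℕ × ℕ), w.1 < 8 ∧ w.2.1 < 8 ∧ w.2.2 < 8 →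
      W (unknownCode l w) = V l (liftMonomial ρ w) := by
    intro l w hw
    have e1 : unknownCode l w / 512 = l := by unfold unknownCode; omega
    have e2 : unknownCode l w / 64 % 8 = w.1 := by unfold unknownCode; omega
    have e3 : unknownCode l w / 8 % 8 = w.2.1 := by unfold unknownCode; omega
    have e4 : unknownCode l w % 8 = w.2.2 := by unfold unknownCode; omega
    simp only [hW, e1, e2, e3, e4]
  have hlift : ∀ u : ℕ × ℕ × ℕ, u.1 ≠ 0 ∧ u.2.1 ≠ 0 ∧ u.2.2 ≠ 0 →
      (liftMonomial ρ u).1 ≠ 0 ∧ (liftMonomial ρ u).2.1 ≠ 0 ∧ (liftMonomial ρ u).2.2 ≠ 0 := by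
    intro u hu
    simp only [liftMonomial, liftDigit]
    split_ifs <;> omega
  have hzero : ∀ x < 3072, W x = 0 := by
    intro x hx
    refine eq_zero_of_codedRelations ?_ ?_ hx
    · intro e he
      rw [codedRelations, List.mem_flatMap] at he
      obtain ⟨t, ht, he⟩ := he
      rw [List.mem_map] at he
      obtain ⟨u, hu, rfl⟩ := he
      obtain ⟨hu0, hu8⟩ := mem_fullMonomials hu
      refine ⟨(relationTerms t u).map fun p => ((p.1 : ℂ), unknownCode p.2.1 p.2.2), ?_, ?_, ?_⟩
      · rw [List.map_map]; rfl
      · intro p hp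
        rw [List.mem_map] at hp
        obtain ⟨r, hr, rfl⟩ := hp
        exact Int.cast_ne_zero.2 (relationTerms_sign_ne_zero hr)
      · have h := hV t (by simp at ht; omega) (liftMonomial ρ u) (hlift u hu0).1 (hlift u hu0).2.1
          (hlift u hu0).2.2
        rw [relationTerms_liftMonomial hρ, List.map_map] at h
        rw [List.map_map, ← h]
        congr 1
        refine List.map_congr_left fun p hp => ?_
        simp only [Function.comp, hcode _ _ (relationTerms_lt_eight hu8 hp)]
    · intro l hl u hu
      obtain ⟨hu0, hu8⟩ := mem_fullMonomials hu
      rw [hcode l u hu8]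
      exact h0 l hl _ (hlift u hu0).1 (hlift u hu0).2.1 (hlift u hu0).2.2
  have hd : ∀ d : ℕ, liftDigit (max d 7) (min d 7) = d := by
    intro d
    unfold liftDigit
    split_ifs <;> omega
  have h := hzero (unknownCode l (min w.1 7, min w.2.1 7, min w.2.2 7)) (by
    simp only [unknownCode]; omega)
  rw [hcode l _ ⟨by simp, by simp, by simp⟩] at h
  simpa only [liftMonomial, hρdef, hd] using h

section Matrices

open scoped Kronecker

/-! ### Ranks of matrices -/

namespace Matrix

variable {m n ι : Type*} [Fintype n]

theorem rank_add_le_rank_add_rank [Finite m] (A B : Matrix m n ℂ) : (A + B).rank ≤ A.rank + B.rank := by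
  rw [rank, rank, rank, mulVecLin_add]
  refine (Submodule.finrank_mono ?_).trans (Submodule.finrank_add_le_finrank_add_finrank _ _)
  rintro _ ⟨x, rfl⟩
  exact Submodule.add_mem_sup ⟨x, rfl⟩ ⟨x, rfl⟩

theorem rank_sum_le_sum_rank [Finite m] (s : Finset ι) (A : ι → Matrix m n ℂ) :
    (∑ i ∈ s, A i).rank ≤ ∑ i ∈ s, (A i).rank := by
  classical
  induction s using Finset.induction_on with
  | empty => simp
  | insert i s hi ih =>
    rw [Finset.sum_insert hi, Finset.sum_insert hi]
    exact (rank_add_le_rank_add_rank _ _).trans (Nat.add_le_add_left ih _)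

/-- The product factors as `(1 ⊗ y) A (1 ⊗ zᵀ)`. -/
theorem rank_kronecker_vecMulVec_le [Fintype m] {κ κ' : Type*} [Fintype κ] [Fintype κ'] (A : Matrix m n ℂ)
    (y : κ → ℂ) (z : κ' → ℂ) : (A ⊗ₖ vecMulVec y z).rank ≤ A.rank := by
  classical
  have h : A ⊗ₖ vecMulVec y z = (of fun (p : m × κ) (i : m) => if p.1 = i then y p.2 else 0) *
      A * (of fun (j : n) (p : n × κ') => if j = p.1 then z p.2 else 0) := by
    ext ⟨i, b⟩ ⟨j, c⟩
    simp [mul_apply, vecMulVec_apply]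
    ring
  rw [h]
  exact (rank_mul_le_left _ _).trans (rank_mul_le_right _ _)

theorem exists_mul_eq_one_of_mulVec_eq_zero [Fintype m] [DecidableEq n] (A : Matrix m n ℂ)
    (hA : ∀ v, A *ᵥ v = 0 → v = 0) : ∃ B : Matrix n m ℂ, B * A = 1 := by
  classical
  obtain ⟨g, hg⟩ := (toLin' A).exists_leftInverse_of_injective (LinearMap.ker_eq_bot'.2 hA)
  refine ⟨LinearMap.toMatrix' g, ?_⟩
  rw [← LinearMap.toMatrix'_id, ← hg, LinearMap.toMatrix'_comp, LinearMap.toMatrix'_toLin']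

end Matrix

/-! ### The Koszul matrices -/

/-- The matrix of `eᵢ ∧ · : ℂ⁴ → Λ² ℂ⁴`, over the integers. -/
def intWedge (i : Fin 4) : Matrix (Fin 6) (Fin 4) ℤ :=
  Matrix.of fun l t => ((incidence t).map fun p => if p.1 = (i : ℕ) ∧ p.2.1 = (l : ℕ) then p.2.2 else 0).sum

/-- The matrix of the pairing `Λ² ℂ⁴ × Λ² ℂ⁴ → Λ⁴ ℂ⁴ = ℂ`, over the integers. -/
def intHodge : Matrix (Fin 6) (Fin 6) ℤ :=
  !![0, 0, 0, 0, 0, 1; 0, 0, 0, 0, -1, 0; 0, 0, 0, 1, 0, 0;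
    0, 0, 1, 0, 0, 0; 0, -1, 0, 0, 0, 0; 1, 0, 0, 0, 0, 0]

/-- The matrix of `eᵢ ∧ · : ℂ⁴ → Λ² ℂ⁴`. -/
def wedge (i : Fin 4) : Matrix (Fin 6) (Fin 4) ℂ := (intWedge i).map (Int.castRingHom ℂ)

/-- The matrix of the pairing `Λ² ℂ⁴ × Λ² ℂ⁴ → Λ⁴ ℂ⁴ = ℂ`. -/
def hodge : Matrix (Fin 6) (Fin 6) ℂ := intHodge.map (Int.castRingHom ℂ)

open Matrix

/-- This is the sign change of `eᵢ ∧ x ∧ eⱼ ∧ y` under exchange of `eᵢ` and `eⱼ`, a finite check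
over the integers. -/
theorem wedge_transpose_mul_hodge_mul_wedge (i j : Fin 4) :
    (wedge i)ᵀ * hodge * wedge j = -((wedge j)ᵀ * hodge * wedge i) := by
  have h : ∀ i j : Fin 4, (intWedge i)ᵀ * intHodge * intWedge j =
      -((intWedge j)ᵀ * intHodge * intWedge i) := by decide +kernel
  have h' := congrArg (fun M : Matrix (Fin 4) (Fin 4) ℤ => (Int.castRingHom ℂ).mapMatrix M) (h i j)
  simpa only [map_neg, RingHom.mapMatrix_apply, Matrix.map_mul, Matrix.transpose_map, wedge,
    hodge] using h'

theorem hodge_mul_hodge : hodge * hodge = 1 := by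
  have h : intHodge * intHodge = 1 := by decide +kernel
  rw [hodge, ← Matrix.map_mul, h, Matrix.map_one _ (map_zero _) (map_one _)]

/-- A double sum of an antisymmetric against a symmetric family vanishes. -/
theorem sum_sum_eq_zero_of_antisymm {ι M : Type*} [Fintype ι] [AddCommGroup M] [Module ℂ M]
    (g : ι → ι → M) (hg : ∀ i j, g i j = -g j i) : ∑ i, ∑ j, g i j = 0 := by
  have h : ∑ i, ∑ j, g i j = -∑ i, ∑ j, g i j := by
    conv_lhs => rw [Finset.sum_comm]
    simp only [← Finset.sum_neg_distrib]
    exact Finset.sum_congr rfl fun i _ => Finset.sum_congr rfl fun j _ => hg j i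
  have h2 : (2 : ℂ) • ∑ i, ∑ j, g i j = 0 := by
    rw [two_smul]
    exact eq_neg_iff_add_eq_zero.1 h
  exact (smul_eq_zero.1 h2).resolve_left two_ne_zero

/-- The matrix of `v ∧ · : ℂ⁴ → Λ² ℂ⁴`. -/
def wedgeVec (v : Fin 4 → ℂ) : Matrix (Fin 6) (Fin 4) ℂ := ∑ i, v i • wedge i

theorem wedgeVec_transpose_mul_hodge_mul_wedgeVec (v : Fin 4 → ℂ) :
    (wedgeVec v)ᵀ * hodge * wedgeVec v = 0 := by
  simp only [wedgeVec, transpose_sum, Matrix.sum_mul, Matrix.mul_sum, transpose_smul,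
    Matrix.smul_mul, Matrix.mul_smul, Finset.smul_sum]
  refine sum_sum_eq_zero_of_antisymm _ fun i j => ?_
  rw [wedge_transpose_mul_hodge_mul_wedge, smul_neg, smul_neg, smul_comm]

theorem wedgeVec_mulVec_self (v : Fin 4 → ℂ) : wedgeVec v *ᵥ v = 0 := by
  have h : ∀ (i j : Fin 4) (l : Fin 6), intWedge i l j = -intWedge j l i := by decide +kernel
  ext l
  simp only [wedgeVec, mulVec, dotProduct, Matrix.sum_apply, Matrix.smul_apply, smul_eq_mul,
    Finset.sum_mul, Pi.zero_apply]
  refine sum_sum_eq_zero_of_antisymm _ fun i j => ?_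
  simp only [wedge, Matrix.map_apply, h j i l, map_neg]
  ring

theorem rank_wedgeVec_le (v : Fin 4 → ℂ) : (wedgeVec v).rank ≤ 3 := by
  by_cases hv : v = 0
  · have : wedgeVec v = 0 := by simp [wedgeVec, hv]
    simp [this]
  · have h := LinearMap.finrank_range_add_finrank_ker (wedgeVec v).mulVecLin
    have hker : 1 ≤ Module.finrank ℂ (LinearMap.ker (wedgeVec v).mulVecLin) := by
      rw [Submodule.one_le_finrank_iff, Submodule.ne_bot_iff]
      exact ⟨v, wedgeVec_mulVec_self v, hv⟩
    rw [Module.finrank_fin_fun] at h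
    rw [rank]
    omega

/-- The Koszul matrix of `(c, v)`: up to a change of basis of the target, the matrix of
`(c, v) ∧ · : Λ² ℂ⁵ → Λ³ ℂ⁵`. -/
def koszul (c : ℂ) (v : Fin 4 → ℂ) : Matrix (Fin 6 ⊕ Fin 4) (Fin 6 ⊕ Fin 4) ℂ :=
  fromBlocks (c • hodge) (hodge * wedgeVec v) ((wedgeVec v)ᵀ * hodge) 0

/-- For `c = 0` the two off-diagonal blocks have rank at most 3 each, since `v ∧ v = 0`. For `c ≠ 0`
the corner `c • hodge` has size 6 and its Schur complement is zero by isotropy of the image of `v ∧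
·`. -/
theorem rank_koszul_le (c : ℂ) (v : Fin 4 → ℂ) : (koszul c v).rank ≤ 6 := by
  by_cases hc : c = 0
  · have h : koszul c v =
        fromRows (1 : Matrix (Fin 6) (Fin 6) ℂ) 0 * (hodge * wedgeVec v) *
          fromCols 0 (1 : Matrix (Fin 4) (Fin 4) ℂ) +
        (fromRows 0 (1 : Matrix (Fin 4) (Fin 4) ℂ) * (wedgeVec v)ᵀ) *
          (hodge * fromCols (1 : Matrix (Fin 6) (Fin 6) ℂ) 0) := by
      ext (i | i) (j | j) <;> simp [koszul, hc, fromRows_mul, mul_fromCols]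
    rw [h]
    refine (rank_add_le_rank_add_rank _ _).trans (add_le_add (b := 3) (d := 3) ?_ ?_)
    · exact (rank_mul_le_left _ _).trans ((rank_mul_le_right _ _).trans
        ((rank_mul_le_right _ _).trans (rank_wedgeVec_le v)))
    · refine (rank_mul_le_left _ _).trans ((rank_mul_le_right _ _).trans ?_)
      rw [rank_transpose]
      exact rank_wedgeVec_le v
  · have h : koszul c v = fromRows 1 (c⁻¹ • (wedgeVec v)ᵀ) *
        fromCols (c • hodge) (hodge * wedgeVec v) := by
      rw [fromRows_mul_fromCols, koszul]
      congr 1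
      · rw [Matrix.one_mul]
      · rw [Matrix.one_mul]
      · rw [Matrix.smul_mul, Matrix.mul_smul, smul_smul, inv_mul_cancel₀ hc, one_smul]
      · rw [Matrix.smul_mul, ← Matrix.mul_assoc, wedgeVec_transpose_mul_hodge_mul_wedgeVec,
          smul_zero]
    rw [h]
    exact (rank_mul_le_left _ _).trans ((rank_le_card_width _).trans (by simp))

/-! ### Multiplication matrices -/

/-- The matrix of the multiplication by `xₐ` on the algebra with basis `1, s, x₂, …, x_{q+1}`. -/
def mulMatrix (q a : ℕ) : Matrix (Fin (q + 2)) (Fin (q + 2)) ℂ :=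
  of fun u w => if digitDiv u a = some (w : ℕ) then 1 else 0

/-- The matrix that forgets the coordinate of `1`. -/
def coordMatrix (q : ℕ) : Matrix (Fin (q + 1)) (Fin (q + 2)) ℂ :=
  of fun b g => if g = b.succ then 1 else 0

/-- The permutation matrix that exchanges `1` and `s`. -/
def swapMatrix (q : ℕ) : Matrix (Fin (q + 2)) (Fin (q + 2)) ℂ :=
  of fun g h => if h = Equiv.swap 0 1 g then 1 else 0

theorem swapMatrix_apply (q : ℕ) (g h : Fin (q + 2)) :
    swapMatrix q g h = if g = Equiv.swap 0 1 h then 1 else 0 := by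
  simp only [swapMatrix, of_apply]
  refine if_congr ⟨fun e => ?_, fun e => ?_⟩ rfl rfl <;> rw [e, Equiv.swap_apply_self]

theorem val_swap_zero_one (q : ℕ) (g : Fin (q + 2)) :
    ((Equiv.swap 0 1 g : Fin (q + 2)) : ℕ) =
      if (g : ℕ) = 0 then 1 else if (g : ℕ) = 1 then 0 else (g : ℕ) := by
  rw [Equiv.swap_apply_def]
  simp only [Fin.ext_iff, Fin.val_zero, Fin.val_one]
  split_ifs <;> simp

theorem mulMatrix_zero (q : ℕ) : mulMatrix q 0 = 1 := by
  ext u w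
  simp [mulMatrix, digitDiv, one_apply, Fin.ext_iff]

/-- The algebra is commutative. The index 1 is excluded because `digitDiv` does not describe
multiplication by `s`. -/
theorem mulMatrix_mul_comm (q : ℕ) {a b : ℕ} (ha : a ≠ 1) (hb : b ≠ 1) :
    mulMatrix q a * mulMatrix q b = mulMatrix q b * mulMatrix q a := by
  by_cases ha0 : a = 0
  · rw [ha0, mulMatrix_zero, Matrix.one_mul, Matrix.mul_one]
  by_cases hb0 : b = 0
  · rw [hb0, mulMatrix_zero, Matrix.one_mul, Matrix.mul_one]
  ext u v
  simp only [mul_apply, mulMatrix, of_apply]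
  refine Finset.sum_congr rfl fun w _ => ?_
  simp only [digitDiv, ha0, hb0, if_false]
  split_ifs <;> simp_all

/-- The swap is the Gram matrix of the Frobenius form that takes the coefficient of `s` in a
product; multiplication operators are self-adjoint for it. -/
theorem mulMatrix_mul_swapMatrix (q a : ℕ) (ha : a ≠ 1) :
    mulMatrix q a * swapMatrix q = swapMatrix q * (mulMatrix q a)ᵀ := by
  ext u h
  have e1 : (mulMatrix q a * swapMatrix q) u h = mulMatrix q a u (Equiv.swap 0 1 h) := by
    simp [mul_apply, swapMatrix_apply]
  have e2 : (swapMatrix q * (mulMatrix q a)ᵀ) u h = mulMatrix q a h (Equiv.swap 0 1 u) := by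
    simp [mul_apply, swapMatrix]
  rw [e1, e2]
  simp only [mulMatrix, of_apply, val_swap_zero_one, digitDiv]
  refine if_congr ?_ rfl rfl
  generalize (u : ℕ) = u
  generalize (h : ℕ) = h
  split_ifs <;> simp <;> omega

theorem swapMatrix_mul_swapMatrix (q : ℕ) : swapMatrix q * swapMatrix q = 1 := by
  ext u v
  simp only [mul_apply, swapMatrix, of_apply, ite_mul, one_mul, zero_mul, Finset.sum_ite_eq',
    Finset.mem_univ, if_true, Equiv.swap_apply_self, one_apply]
  exact if_congr eq_comm rfl rfl

theorem coordMatrix_mul_apply {κ : Type*} (q : ℕ) (M : Matrix (Fin (q + 2)) κ ℂ) (b : Fin (q + 1))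
    (k : κ) : (coordMatrix q * M) b k = M b.succ k := by
  simp [mul_apply, coordMatrix]

/-- The slice of the little Coppersmith–Winograd tensor that belongs to `xₐ`. -/
def sliceMatrix (q a : ℕ) : Matrix (Fin (q + 1)) (Fin (q + 1)) ℂ :=
  coordMatrix q * mulMatrix q a * swapMatrix q * (coordMatrix q)ᵀ

theorem sliceMatrix_apply (q a : ℕ) (b c : Fin (q + 1)) :
    sliceMatrix q a b c = if digitDiv (b + 1) a = some (if (c : ℕ) = 0 then 0 else (c : ℕ) + 1)
      then 1 else 0 := by
  have e : sliceMatrix q a b c = mulMatrix q a b.succ (Equiv.swap 0 1 c.succ) := by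
    rw [sliceMatrix, Matrix.mul_assoc, Matrix.mul_assoc, coordMatrix_mul_apply]
    simp [mul_apply, swapMatrix_apply, coordMatrix]
  rw [e, mulMatrix, of_apply, val_swap_zero_one]
  simp

/-! ### Three factors -/

/-- The index set of the monomials in three factors. -/
abbrev MonomialIndex (q : ℕ) : Type := (Fin (q + 2) × Fin (q + 2)) × Fin (q + 2)

/-- The index set of the coordinates of the third tensor power of `ℂ^{q+1}`. -/
abbrev CubeIndex (q : ℕ) : Type := (Fin (q + 1) × Fin (q + 1)) × Fin (q + 1)

/-- The matrix of the multiplication by the monomial `m`. -/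
def monomialMatrix (q : ℕ) (m : ℕ × ℕ × ℕ) : Matrix (MonomialIndex q) (MonomialIndex q) ℂ :=
  (mulMatrix q m.1 ⊗ₖ mulMatrix q m.2.1) ⊗ₖ mulMatrix q m.2.2

/-- The matrix of the multiplication by `fᵢ`. -/
def elementMatrix (q i : ℕ) : Matrix (MonomialIndex q) (MonomialIndex q) ℂ :=
  ((monomialsOf i).map (monomialMatrix q)).sum

/-- The matrix that forgets the coordinates of monomials with a digit `0`. -/
def cubeCoordMatrix (q : ℕ) : Matrix (CubeIndex q) (MonomialIndex q) ℂ :=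
  (coordMatrix q ⊗ₖ coordMatrix q) ⊗ₖ coordMatrix q

/-- The matrix that exchanges `1` and `s` in all three factors. -/
def cubeSwapMatrix (q : ℕ) : Matrix (MonomialIndex q) (MonomialIndex q) ℂ :=
  (swapMatrix q ⊗ₖ swapMatrix q) ⊗ₖ swapMatrix q

/-- The slice of the Kronecker cube that belongs to the monomial `m`. -/
def cubeSliceMatrix (q : ℕ) (m : ℕ × ℕ × ℕ) : Matrix (CubeIndex q) (CubeIndex q) ℂ :=
  (sliceMatrix q m.1 ⊗ₖ sliceMatrix q m.2.1) ⊗ₖ sliceMatrix q m.2.2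

theorem monomialMatrix_zero (q : ℕ) : monomialMatrix q (0, 0, 0) = 1 := by
  simp [monomialMatrix, mulMatrix_zero]

theorem cubeSwapMatrix_mul_cubeSwapMatrix (q : ℕ) : cubeSwapMatrix q * cubeSwapMatrix q = 1 := by
  simp [cubeSwapMatrix, ← mul_kronecker_mul, swapMatrix_mul_swapMatrix]

theorem cubeCoordMatrix_mul_monomialMatrix (q : ℕ) (m : ℕ × ℕ × ℕ) :
    cubeCoordMatrix q * monomialMatrix q m * cubeSwapMatrix q * (cubeCoordMatrix q)ᵀ =
      cubeSliceMatrix q m := by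
  simp only [cubeCoordMatrix, monomialMatrix, cubeSwapMatrix, cubeSliceMatrix, sliceMatrix,
    ← kroneckerMap_transpose, ← mul_kronecker_mul]

theorem elementMatrix_mul_comm (q i j : ℕ) :
    elementMatrix q i * elementMatrix q j = elementMatrix q j * elementMatrix q i := by
  refine Commute.list_sum_left _ _ fun M hM => Commute.list_sum_right _ _ fun N hN => ?_
  rw [List.mem_map] at hM hN
  obtain ⟨m, hm, rfl⟩ := hM
  obtain ⟨n, hn, rfl⟩ := hN
  have hm := monomialsOf_ne_one _ m hm
  have hn := monomialsOf_ne_one _ n hn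
  simp only [Commute, SemiconjBy, monomialMatrix, ← mul_kronecker_mul,
    mulMatrix_mul_comm q hm.1 hn.1, mulMatrix_mul_comm q hm.2.1 hn.2.1,
    mulMatrix_mul_comm q hm.2.2 hn.2.2]

theorem elementMatrix_mul_cubeSwapMatrix (q i : ℕ) :
    elementMatrix q i * cubeSwapMatrix q = cubeSwapMatrix q * (elementMatrix q i)ᵀ := by
  rw [elementMatrix, transpose_list_sum, ← List.sum_map_mul_right, ← List.sum_map_mul_left,
    List.map_map]
  congr 1
  refine List.map_congr_left fun m hm => ?_
  have hm := monomialsOf_ne_one _ m hm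
  simp only [Function.comp, monomialMatrix, cubeSwapMatrix, ← kroneckerMap_transpose,
    ← mul_kronecker_mul, mulMatrix_mul_swapMatrix q _ hm.1, mulMatrix_mul_swapMatrix q _ hm.2.1,
    mulMatrix_mul_swapMatrix q _ hm.2.2]

theorem cubeCoordMatrix_mul_elementMatrix (q i : ℕ) :
    cubeCoordMatrix q * elementMatrix q i * cubeSwapMatrix q * (cubeCoordMatrix q)ᵀ =
      ((monomialsOf i).map (cubeSliceMatrix q)).sum := by
  rw [elementMatrix]
  induction monomialsOf i with
  | nil => simp
  | cons m ms ih => simp [Matrix.mul_add, Matrix.add_mul, ih, cubeCoordMatrix_mul_monomialMatrix]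

/-! ### The factorization of the flattening -/

/-- The left factor of the flattening of the Kronecker cube. -/
def leftFactor (q : ℕ) : Matrix ((Fin 6 ⊕ Fin 4) × CubeIndex q) (Fin 6 × MonomialIndex q) ℂ :=
  fromRows (1 : Matrix (Fin 6) (Fin 6) ℂ) 0 ⊗ₖ cubeCoordMatrix q +
    ∑ i : Fin 4, fromRows 0 (wedge i)ᵀ ⊗ₖ (cubeCoordMatrix q * elementMatrix q i)

theorem wedgeVec_single (i : Fin 4) : wedgeVec (Pi.single i 1) = wedge i := by
  simp [wedgeVec, Pi.single_apply]

theorem wedgeVec_zero : wedgeVec 0 = 0 := by simp [wedgeVec]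

/-- The product of a block of multiplication matrices with its transpose, for commuting `Y i`. -/
theorem sum_kronecker_mul_hodge_mul_transpose {κ J : Type*} [Fintype κ] [Fintype J]
    (D : Matrix κ J ℂ) (S : Matrix J J ℂ) (Y : Fin 4 → Matrix J J ℂ)
    (hS : ∀ i, Y i * S = S * (Y i)ᵀ) (hcomm : ∀ i j, Y i * Y j = Y j * Y i) :
    (fromRows (1 : Matrix (Fin 6) (Fin 6) ℂ) 0 ⊗ₖ D +
        ∑ i : Fin 4, fromRows 0 (wedge i)ᵀ ⊗ₖ (D * Y i)) * (hodge ⊗ₖ S) *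
      (fromRows (1 : Matrix (Fin 6) (Fin 6) ℂ) 0 ⊗ₖ D +
        ∑ i : Fin 4, fromRows 0 (wedge i)ᵀ ⊗ₖ (D * Y i))ᵀ =
      koszul 1 0 ⊗ₖ (D * S * Dᵀ) +
        ∑ i : Fin 4, koszul 0 (Pi.single i 1) ⊗ₖ (D * Y i * S * Dᵀ) := by
  -- The row blocks are made opaque, so that expanding the product treats them as atoms.
  obtain ⟨P₀, hP₀⟩ : ∃ P₀ : Matrix (Fin 6 ⊕ Fin 4) (Fin 6) ℂ, P₀ = fromRows 1 0 := ⟨_, rfl⟩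
  obtain ⟨P, hP⟩ : ∃ P : Fin 4 → Matrix (Fin 6 ⊕ Fin 4) (Fin 6) ℂ,
    ∀ i, P i = fromRows 0 (wedge i)ᵀ := ⟨_, fun _ => rfl⟩
  have hK0 : P₀ * hodge * P₀ᵀ = koszul 1 0 := by
    ext (a | a) (b | b) <;>
      simp [hP₀, koszul, fromRows_mul, transpose_fromRows, mul_fromCols, wedgeVec_zero]
  have hK : ∀ i, P₀ * hodge * (P i)ᵀ + P i * hodge * P₀ᵀ = koszul 0 (Pi.single i 1) := by
    intro i
    ext (a | a) (b | b) <;>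
      simp [hP₀, hP, koszul, fromRows_mul, transpose_fromRows, mul_fromCols, wedgeVec_single]
  have hPP : ∀ i j, P i * hodge * (P j)ᵀ = -(P j * hodge * (P i)ᵀ) := by
    intro i j
    have h := wedge_transpose_mul_hodge_mul_wedge i j
    ext (a | a) (b | b)
    · simp [hP, fromRows_mul, transpose_fromRows, mul_fromCols]
    · simp [hP, fromRows_mul, transpose_fromRows, mul_fromCols]
    · simp [hP, fromRows_mul, transpose_fromRows, mul_fromCols]
    · simpa [hP, fromRows_mul, transpose_fromRows, mul_fromCols] using congrFun (congrFun h a) b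
  have hYS : ∀ (M : Matrix κ J ℂ) i, M * S * ((Y i)ᵀ * Dᵀ) = M * Y i * S * Dᵀ := by
    intro M i
    rw [Matrix.mul_assoc M, ← Matrix.mul_assoc S, ← hS, Matrix.mul_assoc M, Matrix.mul_assoc M,
      Matrix.mul_assoc]
  -- The terms quadratic in the `Y i` form the lower right block: antisymmetric in the wedge factor,
  -- symmetric in the commuting factor.
  have hzero : ∑ j : Fin 4, ∑ i : Fin 4, (P i * hodge * (P j)ᵀ) ⊗ₖ (D * Y i * Y j * S * Dᵀ) =
      0 := by
    refine sum_sum_eq_zero_of_antisymm _ fun i j => ?_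
    rw [hPP, Matrix.mul_assoc D (Y j), Matrix.mul_assoc D (Y i), hcomm]
    ext a b
    simp [kroneckerMap_apply]
  simp only [← hP₀, ← hP, transpose_add, transpose_sum, ← kroneckerMap_transpose, transpose_mul,
    Matrix.add_mul, Matrix.mul_add, Matrix.sum_mul, Matrix.mul_sum, ← mul_kronecker_mul, hYS]
  rw [Finset.sum_add_distrib, hzero, add_zero, hK0, add_assoc, ← Finset.sum_add_distrib]
  congr 1
  refine Finset.sum_congr rfl fun i _ => ?_
  rw [← add_kronecker, add_comm, hK]

theorem leftFactor_mul (q : ℕ) :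
    leftFactor q * (hodge ⊗ₖ cubeSwapMatrix q) * (leftFactor q)ᵀ =
      koszul 1 0 ⊗ₖ cubeSliceMatrix q (0, 0, 0) +
        ∑ i : Fin 4, koszul 0 (Pi.single i 1) ⊗ₖ ((monomialsOf i).map (cubeSliceMatrix q)).sum := by
  have h0 : cubeCoordMatrix q * cubeSwapMatrix q * (cubeCoordMatrix q)ᵀ =
      cubeSliceMatrix q (0, 0, 0) := by
    rw [← cubeCoordMatrix_mul_monomialMatrix, monomialMatrix_zero, Matrix.mul_one]
  rw [leftFactor, sum_kronecker_mul_hodge_mul_transpose _ _ (fun i : Fin 4 => elementMatrix q i)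
    (fun i => elementMatrix_mul_cubeSwapMatrix q i) (fun i j => elementMatrix_mul_comm q i j), h0]
  simp only [cubeCoordMatrix_mul_elementMatrix]

/-! ### Injectivity of the left factor -/

theorem kronecker_mulVec_apply {m n κ J : Type*} [Fintype n] [Fintype J] (A : Matrix m n ℂ)
    (M : Matrix κ J ℂ) (v : n × J → ℂ) (a : m) (b : κ) :
    ((A ⊗ₖ M) *ᵥ v) (a, b) = ∑ l, A a l * (M *ᵥ fun g => v (l, g)) b := by
  simp only [mulVec, dotProduct, Fintype.sum_prod_type, kroneckerMap_apply, Finset.mul_sum,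
    mul_assoc]

/-- The monomial with index `g`. -/
def monomialVal {q : ℕ} (g : MonomialIndex q) : ℕ × ℕ × ℕ := (g.1.1, g.1.2, g.2)

/-- Extension of a function on `MonomialIndex q` by zero to all monomials. -/
def extendByZero {q : ℕ} (v : MonomialIndex q → ℂ) (w : ℕ × ℕ × ℕ) : ℂ :=
  if h : w.1 < q + 2 ∧ w.2.1 < q + 2 ∧ w.2.2 < q + 2 then
    v ((⟨w.1, h.1⟩, ⟨w.2.1, h.2.1⟩), ⟨w.2.2, h.2.2⟩) else 0

theorem extendByZero_monomialVal {q : ℕ} (v : MonomialIndex q → ℂ) (g : MonomialIndex q) :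
    extendByZero v (monomialVal g) = v g :=
  dif_pos ⟨g.1.1.2, g.1.2.2, g.2.2⟩

theorem monomialMatrix_apply (q : ℕ) (m : ℕ × ℕ × ℕ) (u g : MonomialIndex q) :
    monomialMatrix q m u g =
      if monomialDiv (monomialVal u) m = some (monomialVal g) then 1 else 0 := by
  have h : monomialDiv (monomialVal u) m = some (monomialVal g) ↔
      (digitDiv u.1.1 m.1 = some (g.1.1 : ℕ) ∧ digitDiv u.1.2 m.2.1 = some (g.1.2 : ℕ)) ∧
        digitDiv u.2 m.2.2 = some (g.2 : ℕ) := by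
    simp only [monomialDiv, monomialVal, Option.map_eq_some_iff, Option.bind_eq_some_iff,
      Prod.mk.injEq]
    constructor
    · rintro ⟨a, ha, b, hb, c, hc, rfl, rfl, rfl⟩
      exact ⟨⟨ha, hb⟩, hc⟩
    · rintro ⟨⟨ha, hb⟩, hc⟩
      exact ⟨_, ha, _, hb, _, hc, rfl, rfl, rfl⟩
  simp only [monomialMatrix, mulMatrix, kroneckerMap_apply, of_apply, if_congr h rfl rfl,
    mul_ite, mul_one, mul_zero, ← ite_and, and_comm]

theorem monomialMatrix_mulVec_apply (q : ℕ) (m : ℕ × ℕ × ℕ) (v : MonomialIndex q → ℂ)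
    (u : MonomialIndex q) : (monomialMatrix q m *ᵥ v) u =
      (monomialDiv (monomialVal u) m).elim 0 (extendByZero v) := by
  simp only [mulVec, dotProduct, monomialMatrix_apply]
  cases monomialDiv (monomialVal u) m with
  | none => simp
  | some w =>
    simp only [Option.some.injEq, Option.elim_some, ite_mul, one_mul, zero_mul]
    by_cases h : w.1 < q + 2 ∧ w.2.1 < q + 2 ∧ w.2.2 < q + 2
    · obtain ⟨g, rfl⟩ : ∃ g : MonomialIndex q, w = monomialVal g :=
        ⟨((⟨w.1, h.1⟩, ⟨w.2.1, h.2.1⟩), ⟨w.2.2, h.2.2⟩), rfl⟩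
      rw [extendByZero_monomialVal, Finset.sum_eq_single g]
      · simp
      · intro g' _ hg'
        refine if_neg fun e => hg' ?_
        simp only [monomialVal, Prod.mk.injEq, ← Fin.ext_iff] at e
        exact Prod.ext (Prod.ext e.1.symm e.2.1.symm) e.2.2.symm
      · simp
    · rw [extendByZero, dif_neg h]
      refine Finset.sum_eq_zero fun g _ => if_neg fun e => h ?_
      rw [e]
      exact ⟨g.1.1.2, g.1.2.2, g.2.2⟩

theorem elementMatrix_mulVec_apply (q i : ℕ) (v : MonomialIndex q → ℂ) (u : MonomialIndex q) :
    (elementMatrix q i *ᵥ v) u = ((monomialsOf i).map fun m =>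
      (monomialDiv (monomialVal u) m).elim 0 (extendByZero v)).sum := by
  rw [elementMatrix]
  induction monomialsOf i with
  | nil => simp
  | cons m ms ih => simp [add_mulVec, ih, monomialMatrix_mulVec_apply]

/-- The monomial dual to a coordinate of the cube. -/
def succIndex {q : ℕ} (b : CubeIndex q) : MonomialIndex q := ((b.1.1.succ, b.1.2.succ), b.2.succ)

theorem cubeCoordMatrix_mulVec_apply {q : ℕ} (v : MonomialIndex q → ℂ) (b : CubeIndex q) :
    (cubeCoordMatrix q *ᵥ v) b = v (succIndex b) := by
  simp [mulVec, dotProduct, cubeCoordMatrix, kroneckerMap_apply, coordMatrix,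
    Fintype.sum_prod_type, succIndex]

theorem sum_sum_wedge_mul (t : Fin 4) (X : ℕ → ℕ → ℂ) :
    ∑ i : Fin 4, ∑ l : Fin 6, wedge i l t * X i l =
      ((incidence t).map fun p => (p.2.2 : ℂ) * X p.1 p.2.1).sum := by
  fin_cases t <;> simp [wedge, intWedge, incidence, Fin.sum_univ_succ]

theorem sum_map_relationTerms (V : ℕ → ℕ × ℕ × ℕ → ℂ) (t : ℕ) (u : ℕ × ℕ × ℕ) :
    ((relationTerms t u).map fun p => (p.1 : ℂ) * V p.2.1 p.2.2).sum =
      ((incidence t).map fun p => (p.2.2 : ℂ) *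
        ((monomialsOf p.1).map fun m => (monomialDiv u m).elim 0 (V p.2.1)).sum).sum := by
  rw [relationTerms]
  induction incidence t with
  | nil => rfl
  | cons p ps ih =>
    rw [List.flatMap_cons, List.map_append, List.sum_append, ih, List.map_cons, List.sum_cons]
    congr 1
    induction monomialsOf p.1 with
    | nil => simp
    | cons m ms ih =>
      rw [List.filterMap_cons, List.map_cons, List.sum_cons, mul_add]
      cases monomialDiv u m with
      | none => simpa using ih
      | some w => simpa using ih

/-- A digit of `u` that is at least `q + 2 ≥ 7` is inert and survives the division. Relations
outside the range of indices therefore involve only values extended by zero. -/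
theorem monomialDiv_of_le {q : ℕ} (hq : 5 ≤ q) {u m w : ℕ × ℕ × ℕ}
    (hm : m.1 ≤ 6 ∧ m.2.1 ≤ 6 ∧ m.2.2 ≤ 6)
    (hu : ¬(u.1 < q + 2 ∧ u.2.1 < q + 2 ∧ u.2.2 < q + 2)) (h : monomialDiv u m = some w) :
    ¬(w.1 < q + 2 ∧ w.2.1 < q + 2 ∧ w.2.2 < q + 2) := by
  have key : ∀ {u a w : ℕ}, a ≤ 6 → q + 2 ≤ u → digitDiv u a = some w → q + 2 ≤ w := by
    intro u a w ha hu h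
    unfold digitDiv at h
    split_ifs at h <;> simp at h <;> omega
  simp only [monomialDiv, Option.map_eq_some_iff, Option.bind_eq_some_iff] at h
  obtain ⟨a, ha, b, hb, c, hc, rfl⟩ := h
  rintro ⟨h1, h2, h3⟩
  dsimp only at h1 h2 h3
  refine hu ⟨?_, ?_, ?_⟩
  · exact lt_of_not_ge fun h => absurd (key hm.1 h ha) (not_le.2 h1)
  · exact lt_of_not_ge fun h => absurd (key hm.2.1 h hb) (not_le.2 h2)
  · exact lt_of_not_ge fun h => absurd (key hm.2.2 h hc) (not_le.2 h3)

theorem leftFactor_mulVec_inl (q : ℕ) (v : Fin 6 × MonomialIndex q → ℂ) (l : Fin 6)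
    (b : CubeIndex q) : (leftFactor q *ᵥ v) (Sum.inl l, b) = v (l, succIndex b) := by
  rw [leftFactor, add_mulVec, sum_mulVec, Pi.add_apply, Finset.sum_apply]
  simp [kronecker_mulVec_apply, cubeCoordMatrix_mulVec_apply, one_apply]

theorem leftFactor_mulVec_inr (q : ℕ) (v : Fin 6 × MonomialIndex q → ℂ) (t : Fin 4)
    (b : CubeIndex q) : (leftFactor q *ᵥ v) (Sum.inr t, b) =
      ∑ i : Fin 4, ∑ l : Fin 6, wedge i l t *
        (elementMatrix q i *ᵥ fun g => v (l, g)) (succIndex b) := by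
  rw [leftFactor, add_mulVec, sum_mulVec, Pi.add_apply, Finset.sum_apply]
  simp [kronecker_mulVec_apply, cubeCoordMatrix_mulVec_apply, ← mulVec_mulVec]

theorem eq_zero_of_leftFactor_mulVec {q : ℕ} (hq : 5 ≤ q) (v : Fin 6 × MonomialIndex q → ℂ)
    (hv : leftFactor q *ᵥ v = 0) : v = 0 := by
  set V : ℕ → ℕ × ℕ × ℕ → ℂ := fun l w =>
    if h : l < 6 then extendByZero (fun g => v (⟨l, h⟩, g)) w else 0 with hVdef
  have hVl : ∀ l : Fin 6, V l = extendByZero fun g => v (l, g) := fun l => by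
    funext w
    exact dif_pos l.2
  have hout : ∀ (l : ℕ) (w : ℕ × ℕ × ℕ), ¬(w.1 < q + 2 ∧ w.2.1 < q + 2 ∧ w.2.2 < q + 2) →
      V l w = 0 := by
    intro l w hw
    simp only [hVdef, extendByZero, dif_neg hw]
    split_ifs <;> rfl
  have hsucc : ∀ u : ℕ × ℕ × ℕ, u.1 ≠ 0 → u.2.1 ≠ 0 → u.2.2 ≠ 0 →
      (u.1 < q + 2 ∧ u.2.1 < q + 2 ∧ u.2.2 < q + 2) →
      ∃ b : CubeIndex q, u = monomialVal (succIndex b) := by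
    rintro ⟨a, b, c⟩ ha hb hc ⟨ha', hb', hc'⟩
    dsimp only at ha hb hc ha' hb' hc'
    refine ⟨((⟨a - 1, by omega⟩, ⟨b - 1, by omega⟩), ⟨c - 1, by omega⟩), ?_⟩
    simp only [monomialVal, succIndex, Fin.val_succ, Prod.mk.injEq]
    omega
  have hzero : ∀ l < 6, ∀ w, V l w = 0 := by
    intro l hl w
    -- The vanishing at monomials without digit `0` comes from the upper rows of `leftFactor`, the
    -- relations from its lower rows.
    refine eq_zero_of_relationTerms V ?_ ?_ hl w
    · intro l hl w h1 h2 h3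
      by_cases hw : w.1 < q + 2 ∧ w.2.1 < q + 2 ∧ w.2.2 < q + 2
      · obtain ⟨b, rfl⟩ := hsucc w h1 h2 h3 hw
        have h := congrFun hv (Sum.inl ⟨l, hl⟩, b)
        rw [leftFactor_mulVec_inl] at h
        rw [show V l = V (⟨l, hl⟩ : Fin 6) from rfl, hVl, extendByZero_monomialVal, h]
        rfl
      · exact hout l w hw
    · intro t ht u h1 h2 h3
      rw [sum_map_relationTerms]
      by_cases hu : u.1 < q + 2 ∧ u.2.1 < q + 2 ∧ u.2.2 < q + 2
      · obtain ⟨b, rfl⟩ := hsucc u h1 h2 h3 hu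
        have h := congrFun hv (Sum.inr ⟨t, ht⟩, b)
        rw [leftFactor_mulVec_inr] at h
        simp only [elementMatrix_mulVec_apply, ← hVl] at h
        rw [sum_sum_wedge_mul ⟨t, ht⟩ fun i l => ((monomialsOf i).map fun m =>
          (monomialDiv (monomialVal (succIndex b)) m).elim 0 (V l)).sum] at h
        exact h
      · refine List.sum_eq_zero fun x hx => ?_
        rw [List.mem_map] at hx
        obtain ⟨p, -, rfl⟩ := hx
        refine mul_eq_zero_of_right _ (List.sum_eq_zero fun x hx => ?_)
        rw [List.mem_map] at hx
        obtain ⟨m, hm, rfl⟩ := hx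
        cases hw : monomialDiv u m with
        | none => rfl
        | some w => exact hout _ _ (monomialDiv_of_le hq (monomialsOf_le_six _ m hm) hu hw)
  ext ⟨l, g⟩
  have h := hzero l l.2 (monomialVal g)
  rwa [hVl, extendByZero_monomialVal] at h

/-! ### Flattenings of tensors and border rank -/

section Flattening

variable {A B C A' B' C' κ : Type*}
  [AddCommGroup A] [Module ℂ A] [AddCommGroup B] [Module ℂ B] [AddCommGroup C] [Module ℂ C]
  [AddCommGroup A'] [Module ℂ A'] [AddCommGroup B'] [Module ℂ B'] [AddCommGroup C'] [Module ℂ C']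

/-- The functional `a ⊗ a' ↦ α a * α' a'`. -/
noncomputable def tensorFunctional (α : A →ₗ[ℂ] ℂ) (α' : A' →ₗ[ℂ] ℂ) : A ⊗[ℂ] A' →ₗ[ℂ] ℂ :=
  LinearMap.mul' ℂ ℂ ∘ₗ TensorProduct.map α α'

@[simp]
theorem tensorFunctional_tmul (α : A →ₗ[ℂ] ℂ) (α' : A' →ₗ[ℂ] ℂ) (a : A) (a' : A') :
    tensorFunctional α α' (a ⊗ₜ a') = α a * α' a' := by
  simp [tensorFunctional]

/-- The Kronecker product as a bilinear map. -/
noncomputable def kroneckerBilinear : A ⊗[ℂ] (B ⊗[ℂ] C) →ₗ[ℂ] A' ⊗[ℂ] (B' ⊗[ℂ] C') →ₗ[ℂ]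
    (A ⊗[ℂ] A') ⊗[ℂ] ((B ⊗[ℂ] B') ⊗[ℂ] (C ⊗[ℂ] C')) :=
  (TensorProduct.mk ℂ (A ⊗[ℂ] (B ⊗[ℂ] C)) (A' ⊗[ℂ] (B' ⊗[ℂ] C'))).compr₂
    ((TensorProduct.tensorTensorTensorComm ℂ B C B' C').toLinearMap.lTensor (A ⊗[ℂ] A') ∘ₗ
      (TensorProduct.tensorTensorTensorComm ℂ A (B ⊗[ℂ] C) A' (B' ⊗[ℂ] C')).toLinearMap)

theorem kroneckerBilinear_apply (T : A ⊗[ℂ] (B ⊗[ℂ] C)) (S : A' ⊗[ℂ] (B' ⊗[ℂ] C')) :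
    kroneckerBilinear T S = kronecker T S := rfl

theorem kronecker_sum_sum {ι ι' : Type*} (s : Finset ι) (s' : Finset ι')
    (T : ι → A ⊗[ℂ] (B ⊗[ℂ] C)) (S : ι' → A' ⊗[ℂ] (B' ⊗[ℂ] C')) :
    kronecker (∑ i ∈ s, T i) (∑ j ∈ s', S j) = ∑ i ∈ s, ∑ j ∈ s', kronecker (T i) (S j) := by
  simp only [← kroneckerBilinear_apply, map_sum, LinearMap.sum_apply]
  exact Finset.sum_comm

/-- Both sides are bilinear in `(T, S)` and agree on simple tensors. Thus slices of a Kronecker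
product by product functionals are Kronecker products of slices. -/
theorem tensorFunctional_kronecker (α : A →ₗ[ℂ] ℂ) (β : B →ₗ[ℂ] ℂ) (γ : C →ₗ[ℂ] ℂ)
    (α' : A' →ₗ[ℂ] ℂ) (β' : B' →ₗ[ℂ] ℂ) (γ' : C' →ₗ[ℂ] ℂ) (T : A ⊗[ℂ] (B ⊗[ℂ] C))
    (S : A' ⊗[ℂ] (B' ⊗[ℂ] C')) :
    tensorFunctional (tensorFunctional α α')
        (tensorFunctional (tensorFunctional β β') (tensorFunctional γ γ')) (kronecker T S) =
      tensorFunctional α (tensorFunctional β γ) T *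
        tensorFunctional α' (tensorFunctional β' γ') S := by
  obtain ⟨r, x, y, z, rfl⟩ := exists_isSumOfSimple T
  obtain ⟨r', x', y', z', rfl⟩ := exists_isSumOfSimple S
  rw [kronecker_sum_sum]
  simp only [map_sum, kronecker_tmul, tensorFunctional_tmul, Finset.sum_mul_sum]
  refine Finset.sum_congr rfl fun i _ => Finset.sum_congr rfl fun j _ => ?_
  ring

/-- The matrix of a slice of a tensor of order three. -/
noncomputable def tensorSlice (φ : A →ₗ[ℂ] ℂ) (β : κ → B →ₗ[ℂ] ℂ) (γ : κ → C →ₗ[ℂ] ℂ) :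
    A ⊗[ℂ] (B ⊗[ℂ] C) →ₗ[ℂ] Matrix κ κ ℂ where
  toFun T := of fun b c => tensorFunctional φ (tensorFunctional (β b) (γ c)) T
  map_add' T S := by ext; simp
  map_smul' c T := by ext; simp

theorem tensorSlice_apply (φ : A →ₗ[ℂ] ℂ) (β : κ → B →ₗ[ℂ] ℂ) (γ : κ → C →ₗ[ℂ] ℂ)
    (T : A ⊗[ℂ] (B ⊗[ℂ] C)) (b c : κ) :
    tensorSlice φ β γ T b c = tensorFunctional φ (tensorFunctional (β b) (γ c)) T := rfl

theorem tensorSlice_list_sum (φs : List (A →ₗ[ℂ] ℂ)) (β : κ → B →ₗ[ℂ] ℂ) (γ : κ → C →ₗ[ℂ] ℂ)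
    (T : A ⊗[ℂ] (B ⊗[ℂ] C)) :
    tensorSlice φs.sum β γ T = (φs.map fun φ => tensorSlice φ β γ T).sum := by
  induction φs with
  | nil =>
    ext b c
    simp [tensorSlice_apply, tensorFunctional]
  | cons φ φs ih =>
    rw [List.map_cons, List.sum_cons, List.sum_cons, ← ih]
    ext b c
    rw [Matrix.add_apply, tensorSlice_apply, tensorSlice_apply, tensorSlice_apply,
      tensorFunctional, TensorProduct.map_add_left, LinearMap.comp_add, LinearMap.add_apply]
    rfl

/-- The Koszul flattening of a tensor, with respect to five functionals on the first factor. -/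
noncomputable def flattening (φ₀ : A →ₗ[ℂ] ℂ) (φ : Fin 4 → A →ₗ[ℂ] ℂ) (β : κ → B →ₗ[ℂ] ℂ)
    (γ : κ → C →ₗ[ℂ] ℂ) :
    A ⊗[ℂ] (B ⊗[ℂ] C) →ₗ[ℂ] Matrix ((Fin 6 ⊕ Fin 4) × κ) ((Fin 6 ⊕ Fin 4) × κ) ℂ where
  toFun T := koszul 1 0 ⊗ₖ tensorSlice φ₀ β γ T +
    ∑ i, koszul 0 (Pi.single i 1) ⊗ₖ tensorSlice (φ i) β γ T
  map_add' T S := by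
    simp only [map_add, kronecker_add, Finset.sum_add_distrib]
    abel
  map_smul' c T := by
    simp only [map_smul, kronecker_smul, smul_add, Finset.smul_sum, RingHom.id_apply]

theorem flattening_apply (φ₀ : A →ₗ[ℂ] ℂ) (φ : Fin 4 → A →ₗ[ℂ] ℂ) (β : κ → B →ₗ[ℂ] ℂ)
    (γ : κ → C →ₗ[ℂ] ℂ) (T : A ⊗[ℂ] (B ⊗[ℂ] C)) :
    flattening φ₀ φ β γ T = koszul 1 0 ⊗ₖ tensorSlice φ₀ β γ T +
      ∑ i, koszul 0 (Pi.single i 1) ⊗ₖ tensorSlice (φ i) β γ T := rfl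

theorem koszul_eq_sum (c : ℂ) (v : Fin 4 → ℂ) :
    koszul c v = c • koszul 1 0 + ∑ i, v i • koszul 0 (Pi.single i 1) := by
  ext (a | a) (b | b) <;>
    simp [koszul, Matrix.sum_apply, mul_apply, wedgeVec, Finset.mul_sum, Finset.sum_mul] <;> rw [Finset.sum_comm] <;>
    exact Finset.sum_congr rfl fun i _ => Finset.sum_congr rfl fun j _ => by ring

theorem flattening_tmul (φ₀ : A →ₗ[ℂ] ℂ) (φ : Fin 4 → A →ₗ[ℂ] ℂ) (β : κ → B →ₗ[ℂ] ℂ)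
    (γ : κ → C →ₗ[ℂ] ℂ) (x : A) (y : B) (z : C) :
    flattening φ₀ φ β γ (x ⊗ₜ (y ⊗ₜ z)) =
      koszul (φ₀ x) (fun i => φ i x) ⊗ₖ vecMulVec (fun b => β b y) (fun c => γ c z) := by
  have h : ∀ ψ : A →ₗ[ℂ] ℂ, tensorSlice ψ β γ (x ⊗ₜ (y ⊗ₜ z)) =
      ψ x • vecMulVec (fun b => β b y) (fun c => γ c z) := by
    intro ψ
    ext b c
    simp [tensorSlice_apply, vecMulVec_apply]
  rw [flattening_apply, koszul_eq_sum (φ₀ x)]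
  simp only [h]
  ext ⟨a, b⟩ ⟨a', c⟩
  simp only [Matrix.add_apply, Matrix.sum_apply, kroneckerMap_apply, Matrix.smul_apply,
    smul_eq_mul, add_mul, Finset.sum_mul]
  congr 1
  · ring
  · exact Finset.sum_congr rfl fun i _ => by ring

theorem rank_flattening_le [Fintype κ] (φ₀ : A →ₗ[ℂ] ℂ) (φ : Fin 4 → A →ₗ[ℂ] ℂ)
    (β : κ → B →ₗ[ℂ] ℂ) (γ : κ → C →ₗ[ℂ] ℂ) (T : A ⊗[ℂ] (B ⊗[ℂ] C)) :
    (flattening φ₀ φ β γ T).rank ≤ 6 * tensorRank T := by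
  obtain ⟨x, y, z, h⟩ : IsSumOfSimple T (tensorRank T) :=
    Nat.sInf_mem (exists_isSumOfSimple T)
  have h' : flattening φ₀ φ β γ T = ∑ l, flattening φ₀ φ β γ (x l ⊗ₜ (y l ⊗ₜ z l)) := by
    rw [← map_sum, ← h]
  rw [h']
  refine (rank_sum_le_sum_rank _ _).trans ?_
  refine (Finset.sum_le_card_nsmul _ _ 6 fun l _ => ?_).trans (by simp [mul_comm])
  rw [flattening_tmul]
  exact (rank_kronecker_vecMulVec_le _ _ _).trans (rank_koszul_le _ _)

/-- The border rank bound of the Koszul flattening: if the flattening of `T` can be compressed to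
an invertible matrix of size `N`, then `N` is at most six times the border rank. -/
theorem card_le_of_isLimitOfRankLE [Fintype κ] (φ₀ : A →ₗ[ℂ] ℂ) (φ : Fin 4 → A →ₗ[ℂ] ℂ)
    (β : κ → B →ₗ[ℂ] ℂ) (γ : κ → C →ₗ[ℂ] ℂ) {T : A ⊗[ℂ] (B ⊗[ℂ] C)} {r : ℕ}
    (hT : IsLimitOfRankLE T r) {N : Type*} [Fintype N] [DecidableEq N]
    (P : Matrix N ((Fin 6 ⊕ Fin 4) × κ) ℂ) (Q : Matrix ((Fin 6 ⊕ Fin 4) × κ) N ℂ)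
    (hdet : (P * flattening φ₀ φ β γ T * Q).det ≠ 0) : Fintype.card N ≤ 6 * r := by
  obtain ⟨u, hu, hlim⟩ := hT
  let _ : TopologicalSpace (A ⊗[ℂ] (B ⊗[ℂ] C)) := moduleTopology ℂ _
  have : IsModuleTopology ℂ (A ⊗[ℂ] (B ⊗[ℂ] C)) := ⟨rfl⟩
  -- Linear maps are continuous for the module topology, so nonvanishing of this determinant is an
  -- open condition on the tensor.
  have hcont : Continuous fun S => (P * flattening φ₀ φ β γ S * Q).det :=
    ((continuous_const.matrix_mul
      (IsModuleTopology.continuous_of_linearMap (flattening φ₀ φ β γ))).matrix_mul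
        continuous_const).matrix_det
  have hne := ((hcont.tendsto T).comp hlim).eventually_ne hdet
  obtain ⟨n, hn⟩ := hne.exists
  calc Fintype.card N = (P * flattening φ₀ φ β γ (u n) * Q).rank :=
        (rank_of_det_ne_zero hn).symm
    _ ≤ (flattening φ₀ φ β γ (u n)).rank :=
        (rank_mul_le_left _ _).trans (rank_mul_le_right _ _)
    _ ≤ 6 * tensorRank (u n) := rank_flattening_le _ _ _ _ _
    _ ≤ 6 * r := Nat.mul_le_mul_left _ (hu n)

end Flattening

/-! ### The lower bound -/

/-- The coordinate of `ℂ^{q+1}` dual to `xₐ`. -/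
def coordFunctional (q a : ℕ) : (Fin (q + 1) → ℂ) →ₗ[ℂ] ℂ :=
  -- Truncated subtraction sends `a = 0` to coordinate 0, as wanted; `a = 1` lands there too and is
  -- excluded wherever the functional is evaluated.
  LinearMap.proj (Fin.ofNat (q + 1) (a - 1))

theorem tensorFunctional_littleCW {q a : ℕ} (ha : a ≠ 1) (haq : a ≤ q + 1) (b c : Fin (q + 1)) :
    tensorFunctional (coordFunctional q a)
      (tensorFunctional (LinearMap.proj b) (LinearMap.proj c)) (littleCW q) =
        sliceMatrix q a b c := by
  rw [sliceMatrix_apply]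
  simp only [littleCW, map_sum, map_add, tensorFunctional_tmul, stdVec, coordFunctional,
    LinearMap.proj_apply, Pi.single_apply, Finset.sum_add_distrib]
  obtain ⟨a', rfl⟩ | rfl : (∃ a' : Fin q, a = a' + 2) ∨ a = 0 := by
    by_cases h : a = 0
    · exact Or.inr h
    · exact Or.inl ⟨⟨a - 2, by omega⟩, by simp; omega⟩
  · have e : Fin.ofNat (q + 1) ((a' : ℕ) + 2 - 1) = a'.succ := by
      ext
      simp
    rw [e]
    induction b using Fin.cases <;> induction c using Fin.cases <;>
      simp [digitDiv, Fin.ext_iff]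
    all_goals simp only [← Fin.ext_iff]; simp [eq_comm]
  · have e : Fin.ofNat (q + 1) (0 - 1) = 0 := by ext; simp
    rw [e]
    induction b using Fin.cases <;> induction c using Fin.cases <;>
      simp [digitDiv, Fin.ext_iff]
    all_goals simp only [← Fin.ext_iff]; simp

/-- The coordinate functionals of the third tensor power of `ℂ^{q+1}`. -/
noncomputable def cubeFunctional {q : ℕ} (b : CubeIndex q) :
    ((Fin (q + 1) → ℂ) ⊗[ℂ] (Fin (q + 1) → ℂ)) ⊗[ℂ] (Fin (q + 1) → ℂ) →ₗ[ℂ] ℂ :=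
  tensorFunctional (tensorFunctional (LinearMap.proj b.1.1) (LinearMap.proj b.1.2))
    (LinearMap.proj b.2)

/-- The functional on the third tensor power of `ℂ^{q+1}` dual to the monomial `m`. -/
noncomputable def monomialFunctional (q : ℕ) (m : ℕ × ℕ × ℕ) :
    ((Fin (q + 1) → ℂ) ⊗[ℂ] (Fin (q + 1) → ℂ)) ⊗[ℂ] (Fin (q + 1) → ℂ) →ₗ[ℂ] ℂ :=
  tensorFunctional (tensorFunctional (coordFunctional q m.1) (coordFunctional q m.2.1))
    (coordFunctional q m.2.2)

theorem tensorSlice_monomialFunctional {q : ℕ} (hq : 5 ≤ q) {m : ℕ × ℕ × ℕ}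
    (h1 : m.1 ≠ 1 ∧ m.2.1 ≠ 1 ∧ m.2.2 ≠ 1) (h6 : m.1 ≤ 6 ∧ m.2.1 ≤ 6 ∧ m.2.2 ≤ 6) :
    tensorSlice (monomialFunctional q m) cubeFunctional cubeFunctional
      (kroneckerCube (littleCW q)) = cubeSliceMatrix q m := by
  ext b c
  rw [tensorSlice_apply, kroneckerCube, monomialFunctional, cubeFunctional, cubeFunctional,
    tensorFunctional_kronecker, tensorFunctional_kronecker,
    tensorFunctional_littleCW h1.1 (by omega), tensorFunctional_littleCW h1.2.1 (by omega),
    tensorFunctional_littleCW h1.2.2 (by omega)]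
  rfl

/-- The functional on the third tensor power of `ℂ^{q+1}` dual to `fᵢ`. -/
noncomputable def elementFunctional (q i : ℕ) :
    ((Fin (q + 1) → ℂ) ⊗[ℂ] (Fin (q + 1) → ℂ)) ⊗[ℂ] (Fin (q + 1) → ℂ) →ₗ[ℂ] ℂ :=
  ((monomialsOf i).map (monomialFunctional q)).sum

theorem tensorSlice_elementFunctional {q : ℕ} (hq : 5 ≤ q) (i : ℕ) :
    tensorSlice (elementFunctional q i) cubeFunctional cubeFunctional
      (kroneckerCube (littleCW q)) = ((monomialsOf i).map (cubeSliceMatrix q)).sum := by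
  rw [elementFunctional, tensorSlice_list_sum, List.map_map]
  congr 1
  refine List.map_congr_left fun m hm => ?_
  exact tensorSlice_monomialFunctional hq (monomialsOf_ne_one i m hm) (monomialsOf_le_six i m hm)

theorem le_of_isLimitOfRankLE_kroneckerCube {q r : ℕ} (hq : 5 ≤ q)
    (h : IsLimitOfRankLE (kroneckerCube (littleCW q)) r) : (q + 2) ^ 3 ≤ r := by
  obtain ⟨P, hP⟩ := (leftFactor q).exists_mul_eq_one_of_mulVec_eq_zero
    (eq_zero_of_leftFactor_mulVec hq)
  have hF : flattening (monomialFunctional q (0, 0, 0)) (fun i => elementFunctional q i)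
      cubeFunctional cubeFunctional (kroneckerCube (littleCW q)) =
        leftFactor q * (hodge ⊗ₖ cubeSwapMatrix q) * (leftFactor q)ᵀ := by
    rw [leftFactor_mul, flattening_apply, tensorSlice_monomialFunctional hq (by simp) (by simp)]
    simp only [tensorSlice_elementFunctional hq]
  have hS : (hodge ⊗ₖ cubeSwapMatrix q) * (hodge ⊗ₖ cubeSwapMatrix q) = 1 := by
    rw [← mul_kronecker_mul, hodge_mul_hodge, cubeSwapMatrix_mul_cubeSwapMatrix, one_kronecker_one]
  have hPt : (leftFactor q)ᵀ * Pᵀ = 1 := by rw [← transpose_mul, hP, transpose_one]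
  -- A left inverse of `leftFactor q` and its transpose strip both outer factors, leaving an
  -- involution of size `6 (q + 2) ^ 3`.
  have hcomp : P * flattening (monomialFunctional q (0, 0, 0)) (fun i => elementFunctional q i)
      cubeFunctional cubeFunctional (kroneckerCube (littleCW q)) * Pᵀ =
        hodge ⊗ₖ cubeSwapMatrix q := by
    rw [hF, Matrix.mul_assoc, Matrix.mul_assoc, Matrix.mul_assoc, hPt, Matrix.mul_one,
      ← Matrix.mul_assoc, hP, Matrix.one_mul]
  have hcard := card_le_of_isLimitOfRankLE _ _ _ _ h P Pᵀ (by
    rw [hcomp]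
    intro h0
    have := congrArg det hS
    rw [det_mul, h0, det_one, zero_mul] at this
    exact zero_ne_one this)
  simp only [Fintype.card_prod, Fintype.card_fin] at hcard
  have : 6 * (q + 2) ^ 3 ≤ 6 * r := by
    calc 6 * (q + 2) ^ 3 = 6 * ((q + 2) * (q + 2) * (q + 2)) := by ring
      _ ≤ 6 * r := hcard
  omega

end Matrices

/-! ### The upper bound -/

section UpperBound

variable {A B C A' B' C' : Type*}
  [AddCommGroup A] [Module ℂ A] [AddCommGroup B] [Module ℂ B] [AddCommGroup C] [Module ℂ C]
  [AddCommGroup A'] [Module ℂ A'] [AddCommGroup B'] [Module ℂ B'] [AddCommGroup C'] [Module ℂ C']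

theorem IsSumOfSimple.add {S T : A ⊗[ℂ] (B ⊗[ℂ] C)} {r s : ℕ} (hS : IsSumOfSimple S r)
    (hT : IsSumOfSimple T s) : IsSumOfSimple (S + T) (r + s) := by
  obtain ⟨x, y, z, rfl⟩ := hS
  obtain ⟨x', y', z', rfl⟩ := hT
  refine ⟨Fin.append x x', Fin.append y y', Fin.append z z', ?_⟩
  simp [Fin.sum_univ_add]

theorem isSumOfSimple_tmul (x : A) (y : B) (z : C) : IsSumOfSimple (x ⊗ₜ[ℂ] (y ⊗ₜ[ℂ] z)) 1 :=
  ⟨fun _ => x, fun _ => y, fun _ => z, by simp⟩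

theorem IsSumOfSimple.kronecker {T : A ⊗[ℂ] (B ⊗[ℂ] C)} {S : A' ⊗[ℂ] (B' ⊗[ℂ] C')} {r s : ℕ}
    (hT : IsSumOfSimple T r) (hS : IsSumOfSimple S s) :
    IsSumOfSimple (kronecker T S) (r * s) := by
  obtain ⟨x, y, z, rfl⟩ := hT
  obtain ⟨x', y', z', rfl⟩ := hS
  refine ⟨fun l => x (finProdFinEquiv.symm l).1 ⊗ₜ x' (finProdFinEquiv.symm l).2,
    fun l => y (finProdFinEquiv.symm l).1 ⊗ₜ y' (finProdFinEquiv.symm l).2,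
    fun l => z (finProdFinEquiv.symm l).1 ⊗ₜ z' (finProdFinEquiv.symm l).2, ?_⟩
  rw [kronecker_sum_sum, ← Fintype.sum_prod_type', ← finProdFinEquiv.symm.sum_comp]
  simp only [kronecker_tmul]

theorem tendsto_bilinear [Module.Finite ℂ A] (f : A →ₗ[ℂ] B →ₗ[ℂ] C) {u : ℕ → A} {v : ℕ → B}
    {a : A} {b : B} (hu : Filter.Tendsto u Filter.atTop (@nhds _ (moduleTopology ℂ A) a))
    (hv : Filter.Tendsto v Filter.atTop (@nhds _ (moduleTopology ℂ B) b)) :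
    Filter.Tendsto (fun n => f (u n) (v n)) Filter.atTop
      (@nhds _ (moduleTopology ℂ C) (f a b)) := by
  let _ : TopologicalSpace A := moduleTopology ℂ A
  let _ : TopologicalSpace B := moduleTopology ℂ B
  let _ : TopologicalSpace C := moduleTopology ℂ C
  have : IsModuleTopology ℂ A := ⟨rfl⟩
  have : IsModuleTopology ℂ B := ⟨rfl⟩
  have : IsModuleTopology ℂ C := ⟨rfl⟩
  have h := (IsModuleTopology.continuous_bilinear_of_finite_left f).tendsto (a, b)
  exact h.comp (hu.prodMk_nhds hv)

theorem tendsto_kronecker [Module.Finite ℂ A] [Module.Finite ℂ B] [Module.Finite ℂ C]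
    {u : ℕ → A ⊗[ℂ] (B ⊗[ℂ] C)} {v : ℕ → A' ⊗[ℂ] (B' ⊗[ℂ] C')} {T : A ⊗[ℂ] (B ⊗[ℂ] C)}
    {S : A' ⊗[ℂ] (B' ⊗[ℂ] C')}
    (hu : Filter.Tendsto u Filter.atTop (@nhds _ (moduleTopology ℂ (A ⊗[ℂ] (B ⊗[ℂ] C))) T))
    (hv : Filter.Tendsto v Filter.atTop (@nhds _ (moduleTopology ℂ (A' ⊗[ℂ] (B' ⊗[ℂ] C'))) S)) :
    Filter.Tendsto (fun n => kronecker (u n) (v n)) Filter.atTop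
      (@nhds _ (moduleTopology ℂ ((A ⊗[ℂ] A') ⊗[ℂ] ((B ⊗[ℂ] B') ⊗[ℂ] (C ⊗[ℂ] C'))))
        (kronecker T S)) :=
  tendsto_bilinear kroneckerBilinear hu hv

/-- The tensor `x ⊗ x ⊗ x`. -/
noncomputable def tensorCube (x : A) : A ⊗[ℂ] (A ⊗[ℂ] A) := x ⊗ₜ (x ⊗ₜ x)

/-- The polarization `x ⊗ x ⊗ y + x ⊗ y ⊗ x + y ⊗ x ⊗ x`, as a linear map in `y`. -/
noncomputable def polarization (x : A) : A →ₗ[ℂ] A ⊗[ℂ] (A ⊗[ℂ] A) where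
  toFun y := x ⊗ₜ (x ⊗ₜ y) + x ⊗ₜ (y ⊗ₜ x) + y ⊗ₜ (x ⊗ₜ x)
  map_add' y z := by
    simp only [TensorProduct.tmul_add, TensorProduct.add_tmul]
    abel
  map_smul' c y := by
    simp only [TensorProduct.tmul_smul, ← TensorProduct.smul_tmul', smul_add, RingHom.id_apply]

theorem tensorCube_add_smul (x y : A) (c : ℂ) : tensorCube (x + c • y) =
    tensorCube x + c • polarization x y + c ^ 2 • polarization y x + c ^ 3 • tensorCube y := by
  simp only [tensorCube, polarization, LinearMap.coe_mk, AddHom.coe_mk, TensorProduct.tmul_add,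
    TensorProduct.add_tmul, TensorProduct.tmul_smul, ← TensorProduct.smul_tmul', smul_add, smul_smul]
  module

theorem isSumOfSimple_smul_tensorCube (c : ℂ) (x : A) : IsSumOfSimple (c • tensorCube x) 1 := by
  rw [tensorCube, TensorProduct.smul_tmul']
  exact isSumOfSimple_tmul _ _ _

end UpperBound

/-! ### The degeneration of rank `q + 2`. -/

theorem littleCW_eq_sum_polarization (q : ℕ) :
    littleCW q = ∑ j : Fin q, polarization (stdVec q j.succ) (stdVec q 0) := by
  refine Finset.sum_congr rfl fun j _ => ?_
  simp only [polarization, LinearMap.coe_mk, AddHom.coe_mk]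
  abel

/-- The curve of tensors of rank at most `q + 2` that tends to the little Coppersmith–Winograd
tensor. -/
noncomputable def littleCWCurve (q : ℕ) (ε : ℂ) :
    (Fin (q + 1) → ℂ) ⊗[ℂ] ((Fin (q + 1) → ℂ) ⊗[ℂ] (Fin (q + 1) → ℂ)) :=
  littleCW q + ε • (∑ j : Fin q, tensorCube (stdVec q j.succ) -
    polarization (∑ j : Fin q, stdVec q j.succ) (stdVec q 0)) -
      ε ^ 3 • tensorCube (∑ j : Fin q, stdVec q j.succ)

/-- The cubes of `e₀ + ε eⱼ`, scaled by `ε⁻²`, give the tensor at order zero. One cube of `e₀ + ε² ∑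
eⱼ`, scaled by `-ε⁻³`, cancels all their terms of order `ε⁻¹` at once, and a multiple of the cube of
`e₀` removes the remaining poles. -/
theorem isSumOfSimple_littleCWCurve (q : ℕ) {ε : ℂ} (hε : ε ≠ 0) :
    IsSumOfSimple (littleCWCurve q ε) (q + 2) := by
  have h : littleCWCurve q ε =
      ∑ j : Fin q, (ε ^ 2)⁻¹ • tensorCube (stdVec q 0 + ε • stdVec q j.succ) +
        ((-(ε ^ 3)⁻¹) • tensorCube (stdVec q 0 + ε ^ 2 • ∑ j : Fin q, stdVec q j.succ) +
          ((ε ^ 3)⁻¹ - q * (ε ^ 2)⁻¹) • tensorCube (stdVec q 0)) := by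
    simp only [tensorCube_add_smul, littleCWCurve, littleCW_eq_sum_polarization,
      Finset.sum_add_distrib, smul_add, map_sum, ← Finset.smul_sum, Finset.sum_const,
      Finset.card_univ, Fintype.card_fin, ← Nat.cast_smul_eq_nsmul ℂ, smul_smul, smul_sub]
    match_scalars <;> field_simp <;> ring
  rw [h]
  refine IsSumOfSimple.add ?_
    ((isSumOfSimple_smul_tensorCube _ _).add (isSumOfSimple_smul_tensorCube _ _))
  refine ⟨fun j => (ε ^ 2)⁻¹ • (stdVec q 0 + ε • stdVec q j.succ),
    fun j => stdVec q 0 + ε • stdVec q j.succ, fun j => stdVec q 0 + ε • stdVec q j.succ, ?_⟩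
  simp only [tensorCube, TensorProduct.smul_tmul']

theorem tendsto_littleCWCurve (q : ℕ) :
    Filter.Tendsto (fun n : ℕ => littleCWCurve q (1 / ((n : ℂ) + 1))) Filter.atTop
      (@nhds _ (moduleTopology ℂ _) (littleCW q)) := by
  let _ : TopologicalSpace ((Fin (q + 1) → ℂ) ⊗[ℂ] ((Fin (q + 1) → ℂ) ⊗[ℂ] (Fin (q + 1) → ℂ))) :=
    moduleTopology ℂ _
  have : IsModuleTopology ℂ
    ((Fin (q + 1) → ℂ) ⊗[ℂ] ((Fin (q + 1) → ℂ) ⊗[ℂ] (Fin (q + 1) → ℂ))) := ⟨rfl⟩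
  have : IsTopologicalAddGroup
    ((Fin (q + 1) → ℂ) ⊗[ℂ] ((Fin (q + 1) → ℂ) ⊗[ℂ] (Fin (q + 1) → ℂ))) :=
    IsModuleTopology.topologicalAddGroup ℂ _
  have : ContinuousSMul ℂ
    ((Fin (q + 1) → ℂ) ⊗[ℂ] ((Fin (q + 1) → ℂ) ⊗[ℂ] (Fin (q + 1) → ℂ))) :=
    IsModuleTopology.toContinuousSMul ℂ _
  have hcont : Continuous (littleCWCurve q) := by
    unfold littleCWCurve
    fun_prop
  have h0 : littleCWCurve q 0 = littleCW q := by simp [littleCWCurve]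
  rw [← h0]
  exact (hcont.tendsto 0).comp (tendsto_one_div_add_atTop_nhds_zero_nat (𝕜 := ℂ))

theorem isLimitOfRankLE_kroneckerCube (q : ℕ) :
    IsLimitOfRankLE (kroneckerCube (littleCW q)) ((q + 2) ^ 3) := by
  refine ⟨fun n => kroneckerCube (littleCWCurve q (1 / ((n : ℂ) + 1))), fun n => ?_, ?_⟩
  · have h := isSumOfSimple_littleCWCurve q (one_div_ne_zero (Nat.cast_add_one_ne_zero (R := ℂ) n))
    refine Nat.sInf_le ?_
    rw [pow_succ, sq]
    exact (h.kronecker h).kronecker h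
  · have h := tendsto_littleCWCurve q
    exact tendsto_kronecker (tendsto_kronecker h h) h

theorem theorem4p1 (q : ℕ) (hq : 5 ≤ q) :
    borderRank (kroneckerCube (littleCW q)) = (q + 2) ^ 3 :=
  le_antisymm (Nat.sInf_le (isLimitOfRankLE_kroneckerCube q))
    (le_of_isLimitOfRankLE_kroneckerCube hq
      (Nat.sInf_mem (exists_isLimitOfRankLE (kroneckerCube (littleCW q)))))
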